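/- Identify $\mathbb{C}$ with $\mathbb{R}^2$, write $z=x_1+ix_2$, $\zeta=y_1+iy_2$, let $D_R=\{z\in\mathbb{C}:|z|<R\}$, and let $d\sigma$ denote area measure. For a multi-index $j=(j_1,j_2)$ of non-negative integers put $|j|=j_1+j_2$ and $\partial^j=\partial_1^{j_1}\partial_2^{j_2}$ with $\partial_k=\partial/\partial x_k$; on a function of $z$ and $\zeta$, $\partial^j$ acts on the variable $z$. For $m\ge 0$ let $$P_m[g](z,\zeta)=\sum_{|\alpha|\le m}\frac{(\zeta-z)^{\alpha}}{\alpha!}\,\partial^{\alpha}g(z),\qquad (\zeta-z)^\alpha=(y_1-x_1)^{\alpha_1}(y_2-x_2)^{\alpha_2},\quad \alpha!=\alpha_1!\,\alpha_2!.$$ Let $C^{m,\nu}(D_r)$ be the space of functions in $C^m(D_r)$ whose partial derivatives of order $m$ are locally H\"older continuous with exponent $\nu$ in $D_r$. Let $0<r<1$, $n\ge 3$, $0<\nu\le 1$, and let $f:D_r\to\mathbb{R}$ be an integrable function with $f\in C^{n-2,\nu}(D_r)$. Let $$\omega(z)=\frac1{2\pi}\iint_{D_r}\log|z-\zeta|\,f(\zeta)\,d\sigma_\zeta$$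 be the logarithmic potential of $f$ (the integral converges absolutely for $z\in D_r$). Then $\omega\in C^n(D_r)$. Moreover, let $j$ be a multi-index with $|j|=n$, let $j=e_1+e_2+\cdots+e_n$ be any decomposition with $e_\tau\in\{(1,0),(0,1)\}$, and for $\tau=1,\dots,n-1$ put $$\theta_\tau=e_1+\cdots+e_\tau,\qquad \phi_\tau=e_{\tau+2}+\cdots+e_n\quad(\phi_{n-1}=(0,0)).$$ Then for every $R>r$ and every $z\in D_r$, $$\partial^j\omega(z)=\frac1{2\pi}\iint_{D_R}\partial^j\log|z-\zeta|\cdot\bigl(f(\zeta)-P_{n-2}[f](z,\zeta)\bigr)\,d\sigma_\zeta-\frac1{2\pi}\sum_{\tau=1}^{n-1}\int_{\partial D_R}\partial^{\theta_\tau}\log|z-\zeta|\cdot P_{\tau-1}[\partial^{\phi_\tau}f](z,\zeta)\cdot\langle N(\zeta),e_{\tau+1}\rangle\,|d\zeta|,$$ where all integrals converge absolutely, $N(\zeta)=\zeta/|\zeta|$ is the outward unit normal at $\zeta\in\partial D_R$, $\langle\cdot,\cdot\rangle$ is the Euclidean inner product, and $f$ is extended by zero outside of $D_r$. -/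

import Mathlib

open scoped NNReal Topology

noncomputable section

namespace LogPot

/-- Multi-indices `(j₁, j₂)`; the plane `ℝ²` is identified with `ℂ`. -/
abbrev MultiIndex : Type := ℕ × ℕ

/-- The order `|j| = j₁ + j₂`. -/
def MultiIndex.order (j : MultiIndex) : ℕ := j.1 + j.2

/-- The disk `D_R = {z ∈ ℂ : |z| < R}`. -/
def disk (R : ℝ) : Set ℂ := {z : ℂ | ‖z‖ < R}

/-- The partial derivative `∂₁` in the real coordinate `x₁` of `z = x₁ + i x₂`. -/
def pd₁ (g : ℂ → ℝ) (z : ℂ) : ℝ := lineDeriv ℝ g z 1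

/-- The partial derivative `∂₂` in the real coordinate `x₂` of `z = x₁ + i x₂`. -/
def pd₂ (g : ℂ → ℝ) (z : ℂ) : ℝ := lineDeriv ℝ g z Complex.I

/-- `∂^j = ∂₁^{j₁} ∂₂^{j₂}`. -/
def pd (j : MultiIndex) (g : ℂ → ℝ) : ℂ → ℝ := pd₁^[j.1] (pd₂^[j.2] g)

/-- Local Hölder continuity with exponent `ν` on `U`: every point of `U` has a relative
neighbourhood in `U` on which `g` is Hölder continuous with exponent `ν`. -/
def LocallyHolderOn (ν : ℝ≥0) (g : ℂ → ℝ) (U : Set ℂ) : Prop :=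
  ∀ z ∈ U, ∃ C : ℝ≥0, ∃ s ∈ 𝓝[U] z, HolderOnWith C ν g s

/-- The Hölder class `C^{m,ν}(U)` on an open set `U`: functions of class `C^m` on `U` all of whose
partial derivatives of order `m` are locally Hölder continuous with exponent `ν` in `U`. -/
def HolderClass (m : ℕ) (ν : ℝ≥0) (U : Set ℂ) (g : ℂ → ℝ) : Prop :=
  ContDiffOn ℝ m g U ∧ ∀ α : MultiIndex, α.order = m → LocallyHolderOn ν (pd α g) U

/-- The kernel `log |z - ζ|`, as a function of `z`. -/
def logKernel (ζ : ℂ) (z : ℂ) : ℝ := Real.log ‖z - ζ‖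

/-- The logarithmic potential `(1/2π) ∬_Ω log|z - ζ| f(ζ) dσ_ζ` of `f` on `Ω`. -/
def logPotential (Ω : Set ℂ) (f : ℂ → ℝ) (z : ℂ) : ℝ :=
  1 / (2 * Real.pi) * ∫ ζ in Ω, logKernel ζ z * f ζ

/-- `(ζ - z)^α = (y₁ - x₁)^{α₁} (y₂ - x₂)^{α₂}` for `z = x₁ + i x₂`, `ζ = y₁ + i y₂`. -/
def monomial (α : MultiIndex) (z ζ : ℂ) : ℝ := (ζ.re - z.re) ^ α.1 * (ζ.im - z.im) ^ α.2

/-- The Taylor polynomial `P_m[g](z, ζ) = ∑_{|α| ≤ m} (ζ - z)^α / α! · ∂^α g(z)`. -/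
def taylorPoly (m : ℕ) (g : ℂ → ℝ) (z ζ : ℂ) : ℝ :=
  ∑ k ∈ Finset.range (m + 1), ∑ α ∈ Finset.HasAntidiagonal.antidiagonal k,
    monomial α z ζ / ((α.1.factorial : ℝ) * (α.2.factorial : ℝ)) * pd α g z

/-- A decomposition `j = e_1 + ⋯ + e_n` of the multi-index `j` into `n` unit multi-indices
`e_τ ∈ {(1,0), (0,1)}`, `1 ≤ τ ≤ n`. -/
def IsDecomposition (n : ℕ) (j : MultiIndex) (e : ℕ → MultiIndex) : Prop :=
  (∀ τ ∈ Finset.Icc 1 n, e τ = (1, 0) ∨ e τ = (0, 1)) ∧ ∑ τ ∈ Finset.Icc 1 n, e τ = j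

/-- `θ_τ = e_1 + ⋯ + e_τ`. -/
def theta (e : ℕ → MultiIndex) (τ : ℕ) : MultiIndex := ∑ k ∈ Finset.Icc 1 τ, e k

/-- `φ_τ = e_{τ+2} + ⋯ + e_n`, so that `φ_{n-1} = (0,0)`. -/
def phi (n : ℕ) (e : ℕ → MultiIndex) (τ : ℕ) : MultiIndex := ∑ k ∈ Finset.Icc (τ + 2) n, e k

/-- `⟨N(ζ), e⟩`, where `N(ζ) = ζ / |ζ|` is the outward unit normal at a point `ζ ≠ 0` of the circle
about the origin through `ζ`. -/
def normalDot (ζ : ℂ) (e : MultiIndex) : ℝ :=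
  ζ.re / ‖ζ‖ * (e.1 : ℝ) + ζ.im / ‖ζ‖ * (e.2 : ℝ)

/-- The arc length integral `∫_{∂D_R} g(ζ) |dζ|`, with the parametrization `ζ = R e^{it}`. -/
def boundaryIntegral (R : ℝ) (g : ℂ → ℝ) : ℝ :=
  ∫ t in (0 : ℝ)..(2 * Real.pi), g (circleMap 0 R t) * R

/-- Integrability over the circle `∂D_R` with respect to arc length. -/
def BoundaryIntegrable (R : ℝ) (g : ℂ → ℝ) : Prop :=
  IntervalIntegrable (fun t : ℝ => g (circleMap 0 R t) * R) MeasureTheory.volume 0 (2 * Real.pi)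

/-- The integrand `∂^j log|z - ζ| · (f(ζ) - P_{n-2}[f](z, ζ))` of the area integral, where
`f` is replaced by `0` outside of `D_r`. -/
def areaIntegrand (n : ℕ) (r : ℝ) (f : ℂ → ℝ) (j : MultiIndex) (z ζ : ℂ) : ℝ :=
  pd j (logKernel ζ) z * ((disk r).indicator f ζ - taylorPoly (n - 2) f z ζ)

/-- The integrand `∂^{θ_τ} log|z - ζ| · P_{τ-1}[∂^{φ_τ} f](z, ζ) · ⟨N(ζ), e_{τ+1}⟩` of the
`τ`-th boundary integral. -/
def boundaryIntegrand (n : ℕ) (f : ℂ → ℝ) (e : ℕ → MultiIndex) (τ : ℕ) (z ζ : ℂ) : ℝ :=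
  pd (theta e τ) (logKernel ζ) z * taylorPoly (τ - 1) (pd (phi n e τ) f) z ζ
    * normalDot ζ (e (τ + 1))

end LogPot

end

/-! Differentiating under the integral $n$ times puts $f$ against a kernel of size $|z-\zeta|^{-n}$,
which is not integrable. Subtracting the Taylor polynomial of degree $n-2$ repairs this: the Hölder
condition makes the remainder $O(|\zeta-z|^{n-2+\nu})$ near $z$, so the product is
$O(|\zeta-z|^{-2+\nu})$, integrable in the plane. The subtracted term is recovered by integration by
parts on $D_R$. Each step moves one derivative from the kernel to the polynomial, lowers the degree
by one and leaves a boundary integral; after $n-1$ steps the polynomial is gone.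

To justify this, $\log|w|$ is replaced by the smooth kernel `regLog ε`, which agrees with it for
$|w|\ge\varepsilon$. For smooth kernels the formula is elementary (`pd_potential`,
`setIntegral_disk_pd_mul_taylorSum`, `potential_pd_eq`). For $\varepsilon\le R-r$ the boundary terms
do not see the regularization. The area integral changes only over the disk of radius $\varepsilon$
about $z$, by at most a constant times $\int_{|w|<\varepsilon}|w|^{-2+\nu}$; this combines the
scaling bound `exists_abs_pd_regLog_sub_le` with the Taylor estimate
`HolderClass.exists_abs_sub_taylorSum_le`. Hence all derivatives of order at most $n$ of the
regularized potentials converge locally uniformly (`tendstoLocallyUniformlyOn_pd_potential`), and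
`contDiffOn_of_tendstoLocallyUniformlyOn_pd` yields both the regularity and the formula. -/

namespace LogPot

open Set Filter MeasureTheory

/-! ### Calculus of iterated partial derivatives -/

section PartialDerivatives

variable {U : Set ℂ} {g h : ℂ → ℝ} {z : ℂ}

theorem fderiv_apply_eq_pd (hg : DifferentiableAt ℝ g z) (v : ℂ) :
    fderiv ℝ g z v = v.re * pd₁ g z + v.im * pd₂ g z := by
  have hv : v = v.re • (1 : ℂ) + v.im • Complex.I := by
    apply Complex.ext <;> simp
  rw [pd₁, pd₂, hg.lineDeriv_eq_fderiv, hg.lineDeriv_eq_fderiv]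
  conv_lhs => rw [hv, map_add, map_smul, map_smul]
  simp

theorem fderiv_eq_pd (hg : DifferentiableAt ℝ g z) :
    fderiv ℝ g z = pd₁ g z • Complex.reCLM + pd₂ g z • Complex.imCLM := by
  ext v
  rw [fderiv_apply_eq_pd hg]
  simp [mul_comm]

theorem contDiffOn_lineDeriv (hU : IsOpen U) {m : ℕ} (hg : ContDiffOn ℝ (m + 1 : ℕ) g U) (v : ℂ) :
    ContDiffOn ℝ m (fun z => lineDeriv ℝ g z v) U := by
  have h1 : ContDiffOn ℝ m (fun z => fderiv ℝ g z v) U :=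
    (hg.fderiv_of_isOpen hU (by norm_cast)).clm_apply contDiffOn_const
  refine h1.congr fun z hz => ?_
  exact ((hg.differentiableOn (by simp)).differentiableAt (hU.mem_nhds hz)).lineDeriv_eq_fderiv

theorem contDiffOn_pd₁ (hU : IsOpen U) {m : ℕ} (hg : ContDiffOn ℝ (m + 1 : ℕ) g U) :
    ContDiffOn ℝ m (pd₁ g) U := contDiffOn_lineDeriv hU hg 1

theorem contDiffOn_pd₂ (hU : IsOpen U) {m : ℕ} (hg : ContDiffOn ℝ (m + 1 : ℕ) g U) :
    ContDiffOn ℝ m (pd₂ g) U := contDiffOn_lineDeriv hU hg Complex.I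

theorem contDiffOn_iterate_pd₁ (hU : IsOpen U) {m : ℕ} (a : ℕ)
    (hg : ContDiffOn ℝ (m + a : ℕ) g U) : ContDiffOn ℝ m (pd₁^[a] g) U := by
  induction a generalizing g with
  | zero => exact hg
  | succ a ih => exact ih (contDiffOn_pd₁ hU hg)

theorem contDiffOn_iterate_pd₂ (hU : IsOpen U) {m : ℕ} (a : ℕ)
    (hg : ContDiffOn ℝ (m + a : ℕ) g U) : ContDiffOn ℝ m (pd₂^[a] g) U := by
  induction a generalizing g with
  | zero => exact hg
  | succ a ih => exact ih (contDiffOn_pd₂ hU hg)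

theorem contDiffOn_pd (hU : IsOpen U) {m : ℕ} (j : MultiIndex)
    (hg : ContDiffOn ℝ (m + j.order : ℕ) g U) : ContDiffOn ℝ m (pd j g) U :=
  contDiffOn_iterate_pd₁ hU j.1 (contDiffOn_iterate_pd₂ hU j.2
    (by rwa [add_assoc]))

theorem eqOn_pd₁ (hU : IsOpen U) (hgh : EqOn g h U) : EqOn (pd₁ g) (pd₁ h) U := fun _ hz =>
  (hgh.eventuallyEq_of_mem (hU.mem_nhds hz)).lineDeriv_eq

theorem eqOn_pd₂ (hU : IsOpen U) (hgh : EqOn g h U) : EqOn (pd₂ g) (pd₂ h) U := fun _ hz =>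
  (hgh.eventuallyEq_of_mem (hU.mem_nhds hz)).lineDeriv_eq

theorem eqOn_iterate_pd₁ (hU : IsOpen U) (a : ℕ) (hgh : EqOn g h U) :
    EqOn (pd₁^[a] g) (pd₁^[a] h) U := by
  induction a generalizing g h with
  | zero => exact hgh
  | succ a ih => exact ih (eqOn_pd₁ hU hgh)

theorem eqOn_iterate_pd₂ (hU : IsOpen U) (a : ℕ) (hgh : EqOn g h U) :
    EqOn (pd₂^[a] g) (pd₂^[a] h) U := by
  induction a generalizing g h with
  | zero => exact hgh
  | succ a ih => exact ih (eqOn_pd₂ hU hgh)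

theorem eqOn_pd (hU : IsOpen U) (j : MultiIndex) (hgh : EqOn g h U) :
    EqOn (pd j g) (pd j h) U :=
  eqOn_iterate_pd₁ hU _ (eqOn_iterate_pd₂ hU _ hgh)

theorem pd₂_pd₁ (hU : IsOpen U) (hg : ContDiffOn ℝ 2 g U) :
    EqOn (pd₂ (pd₁ g)) (pd₁ (pd₂ g)) U := by
  intro z hz
  have hd : ∀ y ∈ U, DifferentiableAt ℝ g y := fun y hy =>
    (hg.differentiableOn (by simp)).differentiableAt (hU.mem_nhds hy)
  have hd2 : DifferentiableAt ℝ (fderiv ℝ g) z :=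
    ((hg.fderiv_of_isOpen (m := 1) hU (by norm_num)).differentiableOn (by simp)).differentiableAt
      (hU.mem_nhds hz)
  have key : ∀ v w : ℂ, lineDeriv ℝ (fun y => lineDeriv ℝ g y v) z w
      = fderiv ℝ (fderiv ℝ g) z w v := by
    intro v w
    have h1 : (fun y => lineDeriv ℝ g y v) =ᶠ[𝓝 z] fun y => fderiv ℝ g y v := by
      filter_upwards [hU.mem_nhds hz] with y hy using (hd y hy).lineDeriv_eq_fderiv
    rw [h1.lineDeriv_eq, DifferentiableAt.lineDeriv_eq_fderiv (by fun_prop),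
      fderiv_clm_apply hd2 (by fun_prop)]
    simp
  have hs := (hg.contDiffAt (hU.mem_nhds hz)).isSymmSndFDerivAt (by simp)
  exact (key 1 Complex.I).trans ((hs _ _).trans (key Complex.I 1).symm)

theorem pd₂_iterate_pd₁ (hU : IsOpen U) (a : ℕ) (hg : ContDiffOn ℝ (a + 1 : ℕ) g U) :
    EqOn (pd₂ (pd₁^[a] g)) (pd₁^[a] (pd₂ g)) U := by
  induction a generalizing g with
  | zero => exact fun _ _ => rfl
  | succ a ih =>
    exact (ih (contDiffOn_pd₁ hU hg)).trans
      (eqOn_iterate_pd₁ hU a (pd₂_pd₁ hU (hg.of_le (by norm_cast; omega))))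

theorem iterate_pd₂_iterate_pd₁ (hU : IsOpen U) (a b : ℕ) (hg : ContDiffOn ℝ (a + b : ℕ) g U) :
    EqOn (pd₂^[b] (pd₁^[a] g)) (pd₁^[a] (pd₂^[b] g)) U := by
  induction b generalizing g with
  | zero => exact fun _ _ => rfl
  | succ b ih =>
    exact (eqOn_iterate_pd₂ hU b (pd₂_iterate_pd₁ hU a (hg.of_le (by norm_cast; omega)))).trans
      (ih (contDiffOn_pd₂ hU hg))

/-- Since `pd` always applies $\partial_2$ before $\partial_1$, composing two of them requires
moving the $\partial_2$'s of `j` past the $\partial_1$'s of `φ`, by symmetry of second derivatives.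
-/
theorem pd_pd (hU : IsOpen U) (j φ : MultiIndex) (hg : ContDiffOn ℝ (j.order + φ.order : ℕ) g U) :
    EqOn (pd j (pd φ g)) (pd (j + φ) g) U := by
  have h1 : ContDiffOn ℝ (φ.1 + j.2 : ℕ) (pd₂^[φ.2] g) U :=
    contDiffOn_iterate_pd₂ hU _ (hg.of_le (by simp only [MultiIndex.order]; norm_cast; omega))
  have h2 := eqOn_iterate_pd₁ hU j.1 (iterate_pd₂_iterate_pd₁ hU _ _ h1)
  intro z hz
  refine (h2 hz).trans ?_
  simp [pd, Function.iterate_add_apply]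

theorem pd_zero (g : ℂ → ℝ) : pd 0 g = g := rfl

theorem MultiIndex.order_add (j φ : MultiIndex) : (j + φ).order = j.order + φ.order := by
  simp only [order, Prod.fst_add, Prod.snd_add]; omega

/-- The chain rule for a dilation needs no differentiability, because the rules for `deriv` used
here also hold for its default value. The condition `j ≠ 0` is what kills the constant `c`, later a
logarithm of the scale. -/
theorem pd_comp_smul_add (j : MultiIndex) (hj : j ≠ 0) (g : ℂ → ℝ) (a c : ℝ) (w : ℂ) :
    pd j (fun w => g (a • w) + c) w = a ^ j.order * pd j g (a • w) := by
  have key : ∀ (v : ℂ) (b : ℝ) (c : ℝ) (g : ℂ → ℝ) (w : ℂ),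
      lineDeriv ℝ (fun w => b * g (a • w) + c) w v
      = b * a * lineDeriv ℝ g (a • w) v := by
    intro v b c g w
    simp only [lineDeriv, deriv_add_const, deriv_const_mul_field]
    have := deriv_comp_mul_left a (fun t : ℝ => g (a • w + t • v)) 0
    simp only [mul_zero, smul_eq_mul] at this
    rw [mul_assoc, ← this]
    simp [smul_add, mul_smul]
  have key1 : ∀ (k : ℕ) (b : ℝ) (g : ℂ → ℝ), pd₁^[k] (fun w => b * g (a • w)) =
      fun w => b * a ^ k * pd₁^[k] g (a • w) := by
    intro k
    induction k with
    | zero => simp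
    | succ k ih =>
      intro b g
      have h1 : pd₁ (fun w => b * g (a • w)) = fun w => b * a * pd₁ g (a • w) := by
        funext w
        simpa [pd₁] using key 1 b 0 g w
      rw [Function.iterate_succ_apply, h1, ih]
      funext w
      rw [Function.iterate_succ_apply]; ring
  have key2 : ∀ (k : ℕ) (b : ℝ) (g : ℂ → ℝ), pd₂^[k] (fun w => b * g (a • w)) =
      fun w => b * a ^ k * pd₂^[k] g (a • w) := by
    intro k
    induction k with
    | zero => simp
    | succ k ih =>
      intro b g
      have h1 : pd₂ (fun w => b * g (a • w)) = fun w => b * a * pd₂ g (a • w) := by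
        funext w
        simpa [pd₂] using key Complex.I b 0 g w
      rw [Function.iterate_succ_apply, h1, ih]
      funext w
      rw [Function.iterate_succ_apply]; ring
  obtain ⟨j1, j2⟩ := j
  simp only [pd, MultiIndex.order]
  rcases j2 with _ | j2
  · rcases j1 with _ | j1
    · exact absurd rfl hj
    have h1 : pd₁ (fun w => g (a • w) + c) = fun w => a * pd₁ g (a • w) := by
      funext w
      simpa [pd₁] using key 1 1 c g w
    simp only [Function.iterate_zero, id_eq]
    rw [Function.iterate_succ_apply, h1, key1, Function.iterate_succ_apply]
    simp only [add_zero]; ring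
  · have h1 : pd₂ (fun w => g (a • w) + c) = fun w => a * pd₂ g (a • w) := by
      funext w
      simpa [pd₂] using key Complex.I 1 c g w
    rw [Function.iterate_succ_apply, h1, key2, key1, Function.iterate_succ_apply]
    ring

theorem pd_comp_sub_const (j : MultiIndex) (g : ℂ → ℝ) (ζ z : ℂ) :
    pd j (fun w => g (w - ζ)) z = pd j g (z - ζ) := by
  have key : ∀ (v : ℂ) (g : ℂ → ℝ) (w : ℂ), lineDeriv ℝ (fun w => g (w - ζ)) w v
      = lineDeriv ℝ g (w - ζ) v := by
    intro v g w
    simp only [lineDeriv, add_sub_right_comm]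
  have key1 : ∀ (k : ℕ) (g : ℂ → ℝ), pd₁^[k] (fun w => g (w - ζ)) = fun w => pd₁^[k] g (w - ζ) := by
    intro k
    induction k with
    | zero => simp
    | succ k ih => exact fun g => (congrArg pd₁^[k] (funext fun w => key 1 g w)).trans (ih (pd₁ g))
  have key2 : ∀ (k : ℕ) (g : ℂ → ℝ), pd₂^[k] (fun w => g (w - ζ)) = fun w => pd₂^[k] g (w - ζ) := by
    intro k
    induction k with
    | zero => simp
    | succ k ih =>
      exact fun g => (congrArg pd₂^[k] (funext fun w => key Complex.I g w)).trans (ih (pd₂ g))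
  simp only [pd, key1, key2]

theorem contDiff_pd (j : MultiIndex) (hg : ∀ m : ℕ, ContDiff ℝ m g) (m : ℕ) :
    ContDiff ℝ m (pd j g) :=
  contDiffOn_univ.1 (contDiffOn_pd isOpen_univ j (contDiffOn_univ.2 (hg _)))

theorem pd_pd_of_contDiff (j φ : MultiIndex) (hg : ∀ m : ℕ, ContDiff ℝ m g) :
    pd j (pd φ g) = pd (j + φ) g :=
  funext fun z => pd_pd isOpen_univ j φ (contDiffOn_univ.2 (hg _)) (mem_univ z)

theorem contDiffOn_succ_of_pd (hU : IsOpen U) {m : ℕ} (hg : DifferentiableOn ℝ g U)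
    (h1 : ContDiffOn ℝ m (pd₁ g) U) (h2 : ContDiffOn ℝ m (pd₂ g) U) :
    ContDiffOn ℝ (m + 1 : ℕ) g U := by
  push_cast
  rw [contDiffOn_succ_iff_fderiv_of_isOpen hU]
  refine ⟨hg, by simp, ?_⟩
  refine ((h1.smul contDiffOn_const).add (h2.smul contDiffOn_const)).congr fun z hz =>
    fderiv_eq_pd (hg.differentiableAt (hU.mem_nhds hz))

/-- The direction in the plane of a multi-index, in particular of a unit multi-index. -/
def MultiIndex.dir (e : MultiIndex) : ℂ := ⟨e.1, e.2⟩

theorem pd_unit {e : MultiIndex} (he : e = (1, 0) ∨ e = (0, 1)) (g : ℂ → ℝ) (z : ℂ) :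
    pd e g z = lineDeriv ℝ g z e.dir := by
  rcases he with rfl | rfl
  · have : MultiIndex.dir (1, 0) = 1 := by apply Complex.ext <;> simp [MultiIndex.dir]
    rw [this]; rfl
  · have : MultiIndex.dir (0, 1) = Complex.I := by apply Complex.ext <;> simp [MultiIndex.dir]
    rw [this]; rfl

end PartialDerivatives

/-! ### Divergence theorem and integration by parts on a disk -/

section Divergence

theorem measurableSet_disk (R : ℝ) : MeasurableSet (disk R) :=
  measurableSet_lt measurable_norm measurable_const

theorem isOpen_disk (R : ℝ) : IsOpen (disk R) := isOpen_lt continuous_norm continuous_const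

/-- The integral of a function over a disk, in polar coordinates. -/
theorem setIntegral_disk_eq_polar (R : ℝ) (G : ℂ → ℝ) :
    ∫ ζ in disk R, G ζ = ∫ p in Icc ((0, -Real.pi) : ℝ × ℝ) (R, Real.pi),
      p.1 * G (p.1 * (Real.cos p.2 + Real.sin p.2 * Complex.I)) := by
  rw [← integral_indicator (measurableSet_disk R), ← Complex.integral_comp_polarCoord_symm,
    polarCoord_target]
  have h1 : ∀ p ∈ Ioi (0 : ℝ) ×ˢ Ioo (-Real.pi) Real.pi,
      p.1 • (disk R).indicator G (Complex.polarCoord.symm p) =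
      (Iio R ×ˢ (univ : Set ℝ)).indicator (fun p : ℝ × ℝ =>
        p.1 * G (p.1 * (Real.cos p.2 + Real.sin p.2 * Complex.I))) p := by
    intro p hp
    have hp1 : 0 < p.1 := hp.1
    by_cases h : p.1 < R
    · rw [indicator_of_mem, indicator_of_mem, Complex.polarCoord_symm_apply]
      · rfl
      · exact ⟨h, mem_univ _⟩
      · change ‖_‖ < R
        rwa [Complex.norm_polarCoord_symm, abs_of_pos hp1]
    · rw [indicator_of_notMem, indicator_of_notMem, smul_zero]
      · exact fun h' => h h'.1
      · change ¬ ‖_‖ < R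
        rwa [Complex.norm_polarCoord_symm, abs_of_pos hp1]
  rw [setIntegral_congr_fun (measurableSet_Ioi.prod measurableSet_Ioo) h1,
    setIntegral_indicator (measurableSet_Iio.prod MeasurableSet.univ), prod_inter_prod,
    inter_univ, Ioi_inter_Iio, Icc_prod_eq]
  refine setIntegral_congr_set ?_
  exact Measure.set_prod_ae_eq Ioo_ae_eq_Icc Ioo_ae_eq_Icc

/-- The divergence theorem on a disk, for the constant direction `v`. -/
theorem setIntegral_disk_fderiv {R : ℝ} (hR : 0 < R) {F : ℂ → ℝ} (hF : ContDiff ℝ 1 F) (v : ℂ) :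
    ∫ ζ in disk R, fderiv ℝ F ζ v =
      boundaryIntegral R (fun ζ => F ζ * (ζ.re / ‖ζ‖ * v.re + ζ.im / ‖ζ‖ * v.im)) := by
  rw [setIntegral_disk_eq_polar]
  set γ : ℝ × ℝ → ℂ := fun p => p.1 * (Real.cos p.2 + Real.sin p.2 * Complex.I) with hγ
  have hγd : ContDiff ℝ 1 γ := by
    have h1 : ContDiff ℝ 1 (fun p : ℝ × ℝ => (p.1 : ℂ)) :=
      Complex.ofRealCLM.contDiff.comp contDiff_fst
    have h2 : ContDiff ℝ 1 (fun p : ℝ × ℝ => (Real.cos p.2 : ℂ)) :=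
      Complex.ofRealCLM.contDiff.comp (Real.contDiff_cos.comp contDiff_snd)
    have h3 : ContDiff ℝ 1 (fun p : ℝ × ℝ => (Real.sin p.2 : ℂ)) :=
      Complex.ofRealCLM.contDiff.comp (Real.contDiff_sin.comp contDiff_snd)
    exact h1.mul (h2.add (h3.mul contDiff_const))
  -- `A` and `A'` are the components of `v` along the radial and angular unit vectors. In polar
  -- coordinates the field $Fv$, weighted by the Jacobian, becomes $(\rho A F, A' F)$, whose
  -- divergence in $(\rho,t)$ is $\rho\,DF(v)$ because the terms $\pm A F$ cancel.
  set A : ℝ → ℝ := fun t => Real.cos t * v.re + Real.sin t * v.im with hA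
  set A' : ℝ → ℝ := fun t => -Real.sin t * v.re + Real.cos t * v.im with hA'
  have hAd : ContDiff ℝ 1 (fun p : ℝ × ℝ => A p.2) := by fun_prop
  have hAd' : ContDiff ℝ 1 (fun p : ℝ × ℝ => A' p.2) := by fun_prop
  set f : ℝ × ℝ → ℝ := fun p => p.1 * A p.2 * F (γ p) with hf
  set g : ℝ × ℝ → ℝ := fun p => A' p.2 * F (γ p) with hg
  have hFγ : ContDiff ℝ 1 (fun p => F (γ p)) := hF.comp hγd
  have hfd : ContDiff ℝ 1 f := (contDiff_fst.mul hAd).mul hFγ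
  have hgd : ContDiff ℝ 1 g := hAd'.mul hFγ
  have hdiv : ∀ p : ℝ × ℝ, fderiv ℝ f p (1, 0) + fderiv ℝ g p (0, 1) =
      p.1 * fderiv ℝ F (γ p) v := by
    rintro ⟨ρ, t⟩
    have hFd : HasFDerivAt F (fderiv ℝ F (γ (ρ, t))) (γ (ρ, t)) :=
      ((hF.differentiable (by simp)) _).hasFDerivAt
    have e1 : HasDerivAt (fun s : ℝ => ((s, t) : ℝ × ℝ)) (1, 0) ρ :=
      (hasDerivAt_id ρ).prodMk (hasDerivAt_const ρ t)
    have e2 : HasDerivAt (fun s : ℝ => ((ρ, s) : ℝ × ℝ)) (0, 1) t :=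
      (hasDerivAt_const t ρ).prodMk (hasDerivAt_id t)
    have g1 : HasDerivAt (fun s : ℝ => γ (s, t)) (Real.cos t + Real.sin t * Complex.I) ρ := by
      refine ((hasDerivAt_id ρ).ofReal_comp.mul_const
        ((Real.cos t : ℂ) + Real.sin t * Complex.I)).congr_deriv ?_
      simp
    have g2 : HasDerivAt (fun s : ℝ => γ (ρ, s))
        (ρ * (-Real.sin t + Real.cos t * Complex.I)) t := by
      have hc := (Real.hasDerivAt_cos t).ofReal_comp
      have hs := (Real.hasDerivAt_sin t).ofReal_comp
      refine ((hc.add (hs.mul_const Complex.I)).const_mul (ρ : ℂ)).congr_deriv ?_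
      simp
    have f1 : HasDerivAt (fun s : ℝ => f (s, t)) (A t * F (γ (ρ, t)) +
        ρ * A t * fderiv ℝ F (γ (ρ, t)) (Real.cos t + Real.sin t * Complex.I)) ρ := by
      refine (((hasDerivAt_id ρ).mul_const (A t)).mul (hFd.comp_hasDerivAt ρ g1)).congr_deriv ?_
      simp only [one_mul, id, Function.comp_apply]
    have f2 : HasDerivAt (fun s : ℝ => g (ρ, s)) (-A t * F (γ (ρ, t)) +
        A' t * fderiv ℝ F (γ (ρ, t)) (ρ * (-Real.sin t + Real.cos t * Complex.I))) t := by
      have hA2 : HasDerivAt A' (-A t) t := by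
        have := (((Real.hasDerivAt_sin t).neg).mul_const v.re).add
          ((Real.hasDerivAt_cos t).mul_const v.im)
        refine this.congr_deriv ?_
        simp only [hA]; ring
      exact hA2.mul (hFd.comp_hasDerivAt t g2)
    have hfρ : HasFDerivAt f (fderiv ℝ f (ρ, t)) (ρ, t) :=
      ((hfd.differentiable (by simp)) (ρ, t)).hasFDerivAt
    have hgt : HasFDerivAt g (fderiv ℝ g (ρ, t)) (ρ, t) :=
      ((hgd.differentiable (by simp)) (ρ, t)).hasFDerivAt
    have hfρ' := hfρ.comp_hasDerivAt ρ e1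
    have hgt' := hgt.comp_hasDerivAt t e2
    have k1 := hfρ'.unique f1
    have k2 := hgt'.unique f2
    rw [k1, k2]
    set D := fderiv ℝ F (γ (ρ, t))
    have hv : v = A t • ((Real.cos t : ℂ) + Real.sin t * Complex.I) +
        A' t • (-(Real.sin t : ℂ) + Real.cos t * Complex.I) := by
      have := Real.sin_sq_add_cos_sq t
      apply Complex.ext
      · simp only [hA, hA', Complex.add_re, Complex.smul_re, Complex.neg_re, Complex.mul_re,
          Complex.ofReal_re, Complex.ofReal_im, Complex.I_re, Complex.I_im, smul_eq_mul]
        linear_combination (-v.re) * this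
      · simp only [hA, hA', Complex.add_im, Complex.smul_im, Complex.neg_im, Complex.mul_im,
          Complex.ofReal_re, Complex.ofReal_im, Complex.I_re, Complex.I_im, smul_eq_mul]
        linear_combination (-v.im) * this
    have hρ : (ρ : ℂ) * (-Real.sin t + Real.cos t * Complex.I) =
        ρ • (-(Real.sin t : ℂ) + Real.cos t * Complex.I) := by rw [Complex.real_smul]
    conv_rhs => rw [hv, map_add, map_smul, map_smul]
    rw [hρ, map_smul]
    simp only [smul_eq_mul]
    ring
  have hcont : Continuous fun p => fderiv ℝ f p (1, 0) + fderiv ℝ g p (0, 1) :=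
    ((hfd.continuous_fderiv (by simp)).clm_apply continuous_const).add
      ((hgd.continuous_fderiv (by simp)).clm_apply continuous_const)
  have key := integral_divergence_prod_Icc_of_hasFDerivAt_of_le f g (fderiv ℝ f) (fderiv ℝ g)
    (0, -Real.pi) (R, Real.pi) ⟨hR.le, by simp [Real.pi_pos.le]⟩ hfd.continuous.continuousOn
    hgd.continuous.continuousOn (fun x _ => ((hfd.differentiable (by simp)) x).hasFDerivAt)
    (fun x _ => ((hgd.differentiable (by simp)) x).hasFDerivAt)
    (hcont.continuousOn.integrableOn_compact isCompact_Icc)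
  simp only [hdiv] at key
  refine key.trans ?_
  -- Of the four sides of the rectangle only $\rho=R$ survives: the sides $t=\pm\pi$ cancel, and
  -- $\rho=0$ carries the factor $\rho$.
  have g0 : ∀ x, g (x, Real.pi) = g (x, -Real.pi) := fun x => by simp [hg, hγ, hA']
  have f0 : ∀ y, f (0, y) = 0 := fun y => by simp [hf]
  simp only [g0, f0, sub_self, intervalIntegral.integral_zero, zero_add, sub_zero]
  have hper : Function.Periodic (fun t => f (R, t)) (2 * Real.pi) := fun t => by
    simp only [hf, hγ, hA, Real.cos_add_two_pi, Real.sin_add_two_pi]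
  have := hper.intervalIntegral_add_eq (-Real.pi) 0
  rw [show -Real.pi + 2 * Real.pi = Real.pi by ring, zero_add] at this
  rw [this, boundaryIntegral]
  refine intervalIntegral.integral_congr fun t _ => ?_
  have hc : circleMap 0 R t = γ (R, t) := by
    simp [circleMap, hγ, Complex.exp_mul_I]
  have hn : ‖circleMap 0 R t‖ = R := by simp [abs_of_pos hR]
  have hre : (circleMap 0 R t).re = R * Real.cos t := by
    rw [hc]; simp [hγ, Complex.cos_ofReal_re, Complex.sin_ofReal_re]
  have him : (circleMap 0 R t).im = R * Real.sin t := by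
    rw [hc]; simp [hγ, Complex.cos_ofReal_re, Complex.sin_ofReal_re]
  rw [hn, hre, him, hc]
  simp only [hf, hA]
  field_simp

/-- Integration by parts on a disk, against a kernel depending on the difference of the
variables. -/
theorem setIntegral_disk_pd_mul {R : ℝ} (hR : 0 < R) {k ψ : ℂ → ℝ} (hk : ContDiff ℝ 1 k)
    (hψ : ContDiff ℝ 1 ψ) {e : MultiIndex} (he : e = (1, 0) ∨ e = (0, 1)) (z : ℂ) :
    ∫ ζ in disk R, pd e k (z - ζ) * ψ ζ =
      (∫ ζ in disk R, k (z - ζ) * pd e ψ ζ) -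
        boundaryIntegral R (fun ζ => k (z - ζ) * ψ ζ * normalDot ζ e) := by
  have hk' : ContDiff ℝ 1 (fun ζ => k (z - ζ)) := hk.comp (contDiff_const.sub contDiff_id)
  have h := setIntegral_disk_fderiv hR (hk'.mul hψ) e.dir
  have hkd := hk.differentiable (by simp)
  have hψd := hψ.differentiable (by simp)
  -- Differentiating $k(z-\zeta)$ in $\zeta$ produces a minus sign, so the area term keeps its sign
  -- under integration by parts and the boundary term is subtracted.
  have hD : ∀ ζ, fderiv ℝ (fun ζ => k (z - ζ) * ψ ζ) ζ e.dir =
      k (z - ζ) * pd e ψ ζ - pd e k (z - ζ) * ψ ζ := by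
    intro ζ
    have h1 : HasFDerivAt (fun ζ => k (z - ζ)) (-fderiv ℝ k (z - ζ)) ζ := by
      have := (hkd (z - ζ)).hasFDerivAt.comp ζ ((hasFDerivAt_id ζ).const_sub z)
      refine this.congr_fderiv ?_
      ext v; simp
    rw [show fderiv ℝ (fun ζ => k (z - ζ) * ψ ζ) ζ = _ from
      (h1.mul (hψd ζ).hasFDerivAt).fderiv, pd_unit he, pd_unit he,
      (hkd _).lineDeriv_eq_fderiv, (hψd _).lineDeriv_eq_fderiv]
    simp; ring
  change ∫ ζ in disk R, fderiv ℝ (fun ζ => k (z - ζ) * ψ ζ) ζ e.dir = _ at h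
  simp only [hD] at h
  have hint : ∀ G : ℂ → ℝ, Continuous G → IntegrableOn G (disk R) := fun G hG =>
    (hG.continuousOn.integrableOn_compact (isCompact_closedBall 0 R)).mono_set
      fun ζ hζ => by simpa using le_of_lt (show ‖ζ‖ < R from hζ)
  have hpd : ∀ G : ℂ → ℝ, ContDiff ℝ 1 G → Continuous (pd e G) := by
    intro G hG
    have : pd e G = fun z => fderiv ℝ G z e.dir := by
      funext z
      rw [pd_unit he, ((hG.differentiable (by simp)) z).lineDeriv_eq_fderiv]
    rw [this]
    exact (hG.continuous_fderiv (by simp)).clm_apply continuous_const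
  have hsub : Continuous fun ζ : ℂ => z - ζ := by fun_prop
  have i1 : IntegrableOn (fun ζ => k (z - ζ) * pd e ψ ζ) (disk R) :=
    hint _ (hk'.continuous.mul (hpd _ hψ))
  have i2 : IntegrableOn (fun ζ => pd e k (z - ζ) * ψ ζ) (disk R) :=
    hint _ (((hpd _ hk).comp hsub).mul hψ.continuous)
  rw [integral_sub i1 i2] at h
  have hb : boundaryIntegral R (fun ζ => k (z - ζ) * ψ ζ * normalDot ζ e) =
    boundaryIntegral R (fun ζ => k (z - ζ) * ψ ζ *
      (ζ.re / ‖ζ‖ * e.dir.re + ζ.im / ‖ζ‖ * e.dir.im)) := rfl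
  rw [hb]
  linarith [h]

end Divergence

/-! ### Taylor polynomials and remainder estimates -/

section Taylor

/-- The polynomial in `ζ`, centred at `z`, with Taylor coefficients `c α`, `|α| < q`. -/
noncomputable def taylorSum (q : ℕ) (c : MultiIndex → ℝ) (z ζ : ℂ) : ℝ :=
  ∑ k ∈ Finset.range q, ∑ α ∈ Finset.HasAntidiagonal.antidiagonal k,
    monomial α z ζ / ((α.1.factorial : ℝ) * (α.2.factorial : ℝ)) * c α

theorem taylorPoly_eq_taylorSum (m : ℕ) (g : ℂ → ℝ) (z ζ : ℂ) :
    taylorPoly m g z ζ = taylorSum (m + 1) (fun α => pd α g z) z ζ := rfl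

theorem taylorSum_congr {q : ℕ} {c d : MultiIndex → ℝ}
    (h : ∀ α : MultiIndex, α.order < q → c α = d α)
    (z ζ : ℂ) : taylorSum q c z ζ = taylorSum q d z ζ := by
  refine Finset.sum_congr rfl fun k hk => Finset.sum_congr rfl fun α hα => ?_
  rw [h α]
  rw [Finset.HasAntidiagonal.mem_antidiagonal] at hα
  rw [Finset.mem_range] at hk
  simpa only [MultiIndex.order, hα] using hk

theorem taylorSum_self (q : ℕ) (c : MultiIndex → ℝ) (z : ℂ) :
    taylorSum (q + 1) c z z = c 0 := by
  rw [taylorSum, Finset.sum_range_succ']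
  have : ∀ k ∈ Finset.range q, ∑ α ∈ Finset.HasAntidiagonal.antidiagonal (k + 1),
      monomial α z z / ((α.1.factorial : ℝ) * (α.2.factorial : ℝ)) * c α = 0 := by
    refine fun k _ => Finset.sum_eq_zero fun α hα => ?_
    rw [Finset.HasAntidiagonal.mem_antidiagonal] at hα
    have h : monomial α z z = 0 := by
      rw [monomial, sub_self, sub_self, ← pow_add, hα]; simp
    rw [h]; simp
  rw [Finset.sum_eq_zero this]
  simp [monomial]; rfl

theorem contDiff_taylorSum (q : ℕ) (c : MultiIndex → ℝ) (z : ℂ) (m : ℕ) :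
    ContDiff ℝ m (taylorSum q c z) := by
  have h1 : ContDiff ℝ m (fun ζ : ℂ => ζ.re - z.re) := Complex.reCLM.contDiff.sub contDiff_const
  have h2 : ContDiff ℝ m (fun ζ : ℂ => ζ.im - z.im) := Complex.imCLM.contDiff.sub contDiff_const
  exact ContDiff.sum fun k _ => ContDiff.sum fun α _ =>
    ((((h1.pow _).mul (h2.pow _))).div_const _).mul contDiff_const

theorem hasDerivAt_pow_div_factorial_succ (a : ℕ) (x : ℝ) :
    HasDerivAt (fun s : ℝ => s ^ (a + 1) / ((a + 1).factorial : ℝ)) (x ^ a / a.factorial) x := by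
  refine ((hasDerivAt_pow (a + 1) x).div_const _).congr_deriv ?_
  rw [Nat.factorial_succ]
  push_cast
  have := Nat.factorial_ne_zero a
  field_simp

theorem taylorSum_eq (q : ℕ) (c : MultiIndex → ℝ) (z ζ : ℂ) :
    taylorSum q c z ζ = ∑ k ∈ Finset.range q, ∑ α ∈ Finset.HasAntidiagonal.antidiagonal k,
      ((ζ.re - z.re) ^ α.1 / (α.1.factorial : ℝ)) *
        ((ζ.im - z.im) ^ α.2 / (α.2.factorial : ℝ)) * c α := by
  refine Finset.sum_congr rfl fun k _ => Finset.sum_congr rfl fun α _ => ?_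
  rw [monomial, mul_div_mul_comm]

/-- Each $x^{a+1}/(a+1)!$ differentiates to $x^a/a!$, so a derivative merely shifts the coefficients
and lowers the degree. Leaving the coefficients arbitrary lets the same rule serve the Taylor
estimate and the integration by parts. -/
theorem pd_taylorSum_succ (q : ℕ) (c : MultiIndex → ℝ) (z ζ : ℂ) {e : MultiIndex}
    (he : e = (1, 0) ∨ e = (0, 1)) :
    pd e (taylorSum (q + 1) c z) ζ = taylorSum q (fun α => c (α + e)) z ζ := by
  rcases he with rfl | rfl
  · change deriv (fun t : ℝ => taylorSum (q + 1) c z (ζ + t • 1)) 0 = _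
    have h : (fun t : ℝ => taylorSum (q + 1) c z (ζ + t • 1)) = fun t : ℝ =>
        (∑ k ∈ Finset.range q, (((ζ.im - z.im) ^ (k + 1) / ((k + 1).factorial : ℝ)) * c (0, k + 1) +
          ∑ α ∈ Finset.HasAntidiagonal.antidiagonal k,
          ((ζ.re + t - z.re) ^ (α.1 + 1) / ((α.1 + 1).factorial : ℝ)) *
            ((ζ.im - z.im) ^ α.2 / (α.2.factorial : ℝ)) * c (α.1 + 1, α.2))) + c (0, 0) := by
      funext t
      rw [taylorSum_eq, Finset.sum_range_succ']
      simp [Finset.Nat.sum_antidiagonal_succ]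
    rw [h]
    refine HasDerivAt.deriv ?_
    rw [taylorSum_eq]
    refine HasDerivAt.add_const _ (HasDerivAt.fun_sum fun k _ => ?_)
    refine HasDerivAt.const_add _ (HasDerivAt.fun_sum fun α _ => ?_)
    have h1 : HasDerivAt (fun t : ℝ => ζ.re + t - z.re) 1 0 :=
      ((hasDerivAt_id (0 : ℝ)).const_add ζ.re).sub_const z.re
    have h2 := (hasDerivAt_pow_div_factorial_succ α.1 (ζ.re + 0 - z.re)).comp 0 h1
    refine ((h2.mul_const _).mul_const _).congr_deriv ?_
    rw [add_zero, mul_one]; rfl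
  · change deriv (fun t : ℝ => taylorSum (q + 1) c z (ζ + t • Complex.I)) 0 = _
    have h : (fun t : ℝ => taylorSum (q + 1) c z (ζ + t • Complex.I)) = fun t : ℝ =>
        (∑ k ∈ Finset.range q, (((ζ.re - z.re) ^ (k + 1) / ((k + 1).factorial : ℝ)) * c (k + 1, 0) +
          ∑ α ∈ Finset.HasAntidiagonal.antidiagonal k,
          ((ζ.re - z.re) ^ α.1 / (α.1.factorial : ℝ)) *
          ((ζ.im + t - z.im) ^ (α.2 + 1) / ((α.2 + 1).factorial : ℝ)) *
            c (α.1, α.2 + 1))) + c (0, 0) := by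
      funext t
      rw [taylorSum_eq, Finset.sum_range_succ']
      simp [Finset.Nat.sum_antidiagonal_succ']
    rw [h]
    refine HasDerivAt.deriv ?_
    rw [taylorSum_eq]
    refine HasDerivAt.add_const _ (HasDerivAt.fun_sum fun k _ => ?_)
    refine HasDerivAt.const_add _ (HasDerivAt.fun_sum fun α _ => ?_)
    have h1 : HasDerivAt (fun t : ℝ => ζ.im + t - z.im) 1 0 :=
      ((hasDerivAt_id (0 : ℝ)).const_add ζ.im).sub_const z.im
    have h2 := (hasDerivAt_pow_div_factorial_succ α.2 (ζ.im + 0 - z.im)).comp 0 h1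
    refine ((h2.const_mul _).mul_const _).congr_deriv ?_
    rw [add_zero, mul_one]; rfl

/-- Taylor's estimate: a bound of order `s` for the remainders of order `p` of the partial
derivatives of order `q` gives a bound of order `q + s` for the remainder of order `p + q`. -/
theorem abs_sub_taylorSum_le {U : Set ℂ} (hU : IsOpen U) (hUc : Convex ℝ U) {C s : ℝ} (hC : 0 ≤ C)
    (hs : 0 ≤ s) {p : ℕ} (hp : p ≤ 1) (q : ℕ) {g : ℂ → ℝ} (hg : ContDiffOn ℝ q g U)
    (hbd : ∀ α : MultiIndex, α.order = q → ∀ z ∈ U, ∀ ζ ∈ U,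
      |pd α g ζ - taylorSum p (fun β => pd β (pd α g) z) z ζ| ≤ C * ‖ζ - z‖ ^ s)
    {z ζ : ℂ} (hz : z ∈ U) (hζ : ζ ∈ U) :
    |g ζ - taylorSum (p + q) (fun α => pd α g z) z ζ| ≤ 2 ^ q * C * ‖ζ - z‖ ^ (q + s) := by
  induction q generalizing g ζ with
  | zero => simpa [pd_zero] using hbd 0 rfl z hz ζ hζ
  | succ q ih =>
    have hU1 : ContDiffOn ℝ 1 g U := hg.of_le (by norm_cast; omega)
    have step : ∀ e : MultiIndex, (e = (1, 0) ∨ e = (0, 1)) → ∀ ξ ∈ U,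
        |pd e g ξ - taylorSum (p + q) (fun α => pd (α + e) g z) z ξ|
          ≤ 2 ^ q * C * ‖ξ - z‖ ^ (q + s) := by
      intro e he ξ hξ
      have heo : e.order = 1 := by rcases he with rfl | rfl <;> rfl
      have hpe : ∀ α : MultiIndex, α.order ≤ q → EqOn (pd α (pd e g)) (pd (α + e) g) U :=
        fun α hα => pd_pd hU α e (hg.of_le (by norm_cast; omega))
      have := ih (g := pd e g) (ζ := ξ) (contDiffOn_pd hU e (by rw [heo]; exact hg)) ?_ hξ
      · rwa [taylorSum_congr (fun α hα => hpe α (by omega) hz)] at this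
      · intro α hα x hx ξ hξ
        have h1 := hbd (α + e) (by rw [MultiIndex.order_add, hα, heo]) x hx ξ hξ
        rw [← hpe α (by omega) hξ] at h1
        rwa [taylorSum_congr (fun β hβ => eqOn_pd hU β (hpe α (by omega)) hx)]
    have hTd : Differentiable ℝ (taylorSum (p + q + 1) (fun α => pd α g z) z) :=
      (contDiff_taylorSum _ _ _ 1).differentiable (by simp)
    have hgd : ∀ ξ ∈ U, DifferentiableAt ℝ g ξ := fun ξ hξ =>
      (hU1.differentiableOn (by simp)).differentiableAt (hU.mem_nhds hξ)
    -- Still convex and containing both points, and on it $|\xi-z|\le|\zeta-z|$; the bound on the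
    -- gradient is therefore uniform and the mean value inequality supplies one more factor
    -- $|\zeta-z|$. The two partial derivatives account for the factor 2 per step.
    set S := U ∩ Metric.closedBall z ‖ζ - z‖ with hS
    have hSc : Convex ℝ S := hUc.inter (convex_closedBall _ _)
    have hzS : z ∈ S := ⟨hz, Metric.mem_closedBall_self (norm_nonneg _)⟩
    have hζS : ζ ∈ S := ⟨hζ, by rw [mem_closedBall_iff_norm]⟩
    have hb : ∀ ξ ∈ S, ‖fderiv ℝ (fun ξ => g ξ - taylorSum (p + q + 1) (fun α => pd α g z) z ξ) ξ‖
        ≤ 2 ^ (q + 1) * C * ‖ζ - z‖ ^ (q + s) := by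
      intro ξ hξ
      have hle : 2 ^ q * C * ‖ξ - z‖ ^ (q + s) ≤ 2 ^ q * C * ‖ζ - z‖ ^ (q + s) :=
        mul_le_mul_of_nonneg_left (Real.rpow_le_rpow (norm_nonneg _)
          (mem_closedBall_iff_norm.1 hξ.2) (by positivity)) (by positivity)
      have e1 := (step (1, 0) (Or.inl rfl) ξ hξ.1).trans hle
      have e2 := (step (0, 1) (Or.inr rfl) ξ hξ.1).trans hle
      refine ContinuousLinearMap.opNorm_le_bound _ (by positivity) fun v => ?_
      rw [fderiv_fun_sub (hgd ξ hξ.1) (hTd ξ), sub_apply,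
        fderiv_apply_eq_pd (hgd ξ hξ.1), fderiv_apply_eq_pd (hTd ξ)]
      have t1 : pd₁ (taylorSum (p + q + 1) (fun α => pd α g z) z) ξ = _ :=
        pd_taylorSum_succ (p + q) (fun α => pd α g z) z ξ (Or.inl rfl)
      have t2 : pd₂ (taylorSum (p + q + 1) (fun α => pd α g z) z) ξ = _ :=
        pd_taylorSum_succ (p + q) (fun α => pd α g z) z ξ (Or.inr rfl)
      rw [t1, t2]
      change |pd₁ g ξ - _| ≤ _ at e1
      change |pd₂ g ξ - _| ≤ _ at e2
      set A := pd₁ g ξ - taylorSum (p + q) (fun α => pd (α + (1, 0)) g z) z ξ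
      set B := pd₂ g ξ - taylorSum (p + q) (fun α => pd (α + (0, 1)) g z) z ξ
      have : ∀ x y x' y' : ℝ, v.re * x + v.im * y - (v.re * x' + v.im * y') =
        v.re * (x - x') + v.im * (y - y') := fun _ _ _ _ => by ring
      rw [this]
      set M := 2 ^ q * C * ‖ζ - z‖ ^ (q + s)
      calc ‖v.re * A + v.im * B‖ ≤ ‖v.re * A‖ + ‖v.im * B‖ := norm_add_le _ _
        _ = |v.re| * |A| + |v.im| * |B| := by simp
        _ ≤ ‖v‖ * M + ‖v‖ * M := by
          gcongr
          · exact Complex.abs_re_le_norm v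
          · exact Complex.abs_im_le_norm v
        _ = _ := by simp only [M]; ring
    have := hSc.norm_image_sub_le_of_norm_fderiv_le
      (fun ξ hξ => (hgd ξ hξ.1).fun_sub (hTd ξ)) hb hzS hζS
    rw [taylorSum_self, pd_zero, sub_self, sub_zero, Real.norm_eq_abs] at this
    refine this.trans (le_of_eq ?_)
    rcases (norm_nonneg (ζ - z)).eq_or_lt with h0 | h0
    · rw [← h0, mul_zero, Real.zero_rpow (by positivity), mul_zero]
    · rw [mul_assoc, ← Real.rpow_add_one h0.ne']
      push_cast
      ring_nf

/-- For `q = N + 1` the Hölder condition on the derivatives of order `N` is used. For `q ≤ N` local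
boundedness of the derivatives of order `q` gives the exponent `q`, which is weakened to `q - 1 + ν`
so that one exponent covers all orders. The point `ζ = z` is excluded because for `q = 0` and `ν <
1` the exponent is negative and the power at 0 is 0 by convention. -/
theorem HolderClass.exists_abs_sub_taylorSum_le {N : ℕ} {ν : ℝ≥0} (hν : ν ≤ 1) {U : Set ℂ}
    (hU : IsOpen U) {f : ℂ → ℝ} (hf : HolderClass N ν U f) {q : ℕ} (hq : q ≤ N + 1) {z₀ : ℂ}
    (hz₀ : z₀ ∈ U) : ∃ C δ : ℝ, 0 ≤ C ∧ 0 < δ ∧ Metric.ball z₀ δ ⊆ U ∧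
      ∀ z ∈ Metric.ball z₀ δ, ∀ ζ ∈ Metric.ball z₀ δ, ζ ≠ z →
        |f ζ - taylorSum q (fun α => pd α f z) z ζ| ≤ C * ‖ζ - z‖ ^ ((q : ℝ) - 1 + ν) := by
  -- The case `p = 1` compares the derivatives of order `q` with their value at `z`, the case `p =
  -- 0` only bounds them. The radius is at most `1 / 2` so that any two points of the ball are less
  -- than 1 apart, which permits lowering the exponent.
  have main : ∀ (p q : ℕ) (s : ℝ), p ≤ 1 → 0 ≤ s → q ≤ N →
      (∀ α : MultiIndex, α.order = q → ∃ C : ℝ, 0 ≤ C ∧ ∃ S ∈ 𝓝 z₀, ∀ z ∈ S, ∀ ζ ∈ S,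
        |pd α f ζ - taylorSum p (fun β => pd β (pd α f) z) z ζ| ≤ C * ‖ζ - z‖ ^ s) →
      ∃ C δ : ℝ, 0 ≤ C ∧ 0 < δ ∧ δ ≤ 1 / 2 ∧ Metric.ball z₀ δ ⊆ U ∧
        ∀ z ∈ Metric.ball z₀ δ, ∀ ζ ∈ Metric.ball z₀ δ,
        |f ζ - taylorSum (p + q) (fun α => pd α f z) z ζ| ≤ C * ‖ζ - z‖ ^ (q + s) := by
    intro p q s hp hs hqN H
    choose! C hC S hS hbd using H
    set I := Finset.HasAntidiagonal.antidiagonal q with hI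
    have hmem : ∀ α : MultiIndex, α ∈ I ↔ α.order = q := fun α =>
      Finset.HasAntidiagonal.mem_antidiagonal
    have hT : (⋂ α ∈ I, S α) ∩ U ∈ 𝓝 z₀ :=
      inter_mem ((biInter_finset_mem I).2 fun α hα => hS α ((hmem α).1 hα)) (hU.mem_nhds hz₀)
    obtain ⟨δ, hδ, hball⟩ := Metric.mem_nhds_iff.1 hT
    have hsub : Metric.ball z₀ (min δ (1 / 2)) ⊆ (⋂ α ∈ I, S α) ∩ U :=
      (Metric.ball_subset_ball (min_le_left _ _)).trans hball
    have hCs : 0 ≤ ∑ α ∈ I, C α := Finset.sum_nonneg fun α hα => hC α ((hmem α).1 hα)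
    refine ⟨2 ^ q * ∑ α ∈ I, C α, min δ (1 / 2), by positivity, by positivity, min_le_right _ _,
      fun x hx => (hsub hx).2, fun z hz ζ hζ => ?_⟩
    refine abs_sub_taylorSum_le Metric.isOpen_ball (convex_ball _ _) hCs hs hp q
      ((hf.1.of_le (by exact_mod_cast hqN)).mono fun x hx => (hsub hx).2) ?_ hz hζ
    · intro α hα x hx ξ hξ
      refine (hbd α hα x (mem_iInter₂.1 (hsub hx).1 α ((hmem α).2 hα)) ξ
        (mem_iInter₂.1 (hsub hξ).1 α ((hmem α).2 hα))).trans ?_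
      gcongr
      exact Finset.single_le_sum (f := C) (fun α hα => hC α ((hmem α).1 hα)) ((hmem α).2 hα)
  rcases Nat.lt_or_ge N q with h | h
  · obtain rfl : q = 1 + N := by omega
    obtain ⟨C, δ, hC, hδ, _, hU', hb⟩ := main 1 N ν le_rfl ν.2 le_rfl (fun α hα => by
      obtain ⟨C, S, hS, hH⟩ := hf.2 α hα z₀ hz₀
      rw [hU.nhdsWithin_eq hz₀] at hS
      refine ⟨C, C.2, S, hS, fun z hz ζ hζ => ?_⟩
      have := hH.dist_le hζ hz
      rw [Real.dist_eq, dist_eq_norm] at this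
      have h0 : ∀ g, pd (0, 0) g = g := pd_zero
      simpa [taylorSum, monomial, h0] using this)
    refine ⟨C, δ, hC, hδ, hU', fun z hz ζ hζ _ => ?_⟩
    have := hb z hz ζ hζ
    rwa [show ((1 + N : ℕ) : ℝ) - 1 + ν = N + ν by push_cast; ring]
  · obtain ⟨C, δ, hC, hδ, hδ', hU', hb⟩ := main 0 q 0 zero_le_one le_rfl h (fun α hα => by
      have hc : ContinuousAt (pd α f) z₀ :=
        (contDiffOn_pd hU (m := 0) α (hf.1.of_le (by norm_cast; omega))).continuousOn.continuousAt
          (hU.mem_nhds hz₀)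
      refine ⟨|pd α f z₀| + 1, by positivity, {x | |pd α f x| < |pd α f z₀| + 1},
        hc.abs.eventually_lt continuousAt_const (lt_add_one _), fun z _ ζ hζ => ?_⟩
      simpa [taylorSum] using le_of_lt hζ)
    refine ⟨C, δ, hC, hδ, hU', fun z hz ζ hζ hne => ?_⟩
    have := hb z hz ζ hζ
    rw [zero_add] at this
    refine this.trans (mul_le_mul_of_nonneg_left ?_ hC)
    have hpos : 0 < ‖ζ - z‖ := norm_pos_iff.2 (sub_ne_zero.2 hne)
    refine Real.rpow_le_rpow_of_exponent_ge hpos ?_ ?_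
    · have := dist_triangle_right ζ z z₀
      rw [Metric.mem_ball] at hz hζ
      rw [← dist_eq_norm]; linarith
    · have : (ν : ℝ) ≤ 1 := hν
      linarith

end Taylor

/-! ### The logarithmic kernel, its regularization and weak singularities -/

section Kernel

/-- The fundamental kernel `log |w|`. -/
noncomputable def logNorm (w : ℂ) : ℝ := Real.log ‖w‖

/-- A bump function which equals `1` near the origin and vanishes outside `D_{1/2}`. -/
noncomputable def originBump : ContDiffBump (0 : ℂ) := ⟨1 / 4, 1 / 2, by norm_num, by norm_num⟩

/-- A smooth function on the plane which agrees with `log |w|` for `|w| ≥ 1 / 2`. -/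
noncomputable def smoothLog (w : ℂ) : ℝ := (1 - originBump w) * logNorm w

/-- A smooth function on the plane which agrees with `log |w|` for `|w| ≥ ε / 2`. -/
noncomputable def regLog (ε : ℝ) (w : ℂ) : ℝ := smoothLog (ε⁻¹ • w) + Real.log ε

theorem contDiffOn_logNorm (m : ℕ) : ContDiffOn ℝ m logNorm {0}ᶜ := fun _ hw =>
  ((contDiffAt_norm ℝ hw).log (norm_ne_zero_iff.2 hw)).contDiffWithinAt

theorem smoothLog_eq {w : ℂ} (hw : 1 / 2 ≤ ‖w‖) : smoothLog w = logNorm w := by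
  rw [smoothLog, originBump.zero_of_le_dist (by simpa [originBump] using hw), sub_zero, one_mul]

theorem contDiff_smoothLog (m : ℕ) : ContDiff ℝ m smoothLog := by
  rw [contDiff_iff_contDiffAt]
  intro w
  rcases eq_or_ne w 0 with rfl | hw
  · refine (contDiffAt_const (c := (0 : ℝ))).congr_of_eventuallyEq ?_
    filter_upwards [originBump.eventuallyEq_one] with w hw
    rw [smoothLog, hw]; simp
  · exact (contDiffAt_const.sub originBump.contDiffAt).mul
      ((contDiffOn_logNorm m).contDiffAt (isOpen_compl_singleton.mem_nhds hw))

theorem contDiff_regLog (ε : ℝ) (m : ℕ) : ContDiff ℝ m (regLog ε) :=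
  ((contDiff_smoothLog m).comp (contDiff_const_smul _)).add contDiff_const

theorem logNorm_smul {a : ℝ} (ha : 0 < a) {w : ℂ} (hw : w ≠ 0) :
    logNorm (a • w) = Real.log a + logNorm w := by
  rw [logNorm, norm_smul, Real.norm_of_nonneg ha.le,
    Real.log_mul ha.ne' (norm_ne_zero_iff.2 hw), logNorm]

theorem pd_logNorm_smul (j : MultiIndex) (hj : j ≠ 0) {a : ℝ} (ha : 0 < a) {w : ℂ} (hw : w ≠ 0) :
    pd j logNorm w = a ^ j.order * pd j logNorm (a • w) := by
  rw [← pd_comp_smul_add j hj logNorm a (-Real.log a) w]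
  refine eqOn_pd isOpen_compl_singleton j (fun x hx => ?_) (show w ∈ ({0}ᶜ : Set ℂ) from hw)
  rw [logNorm_smul ha hx]; ring

/-- Both kernels are obtained from their versions at scale 1 by the same dilation and the same
additive constant $\log\varepsilon$, so the difference scales exactly, including at order 0. -/
theorem pd_regLog_sub (j : MultiIndex) {ε : ℝ} (hε : 0 < ε) {w : ℂ} (hw : w ≠ 0) :
    pd j (regLog ε) w - pd j logNorm w =
      ε⁻¹ ^ j.order * (pd j smoothLog (ε⁻¹ • w) - pd j logNorm (ε⁻¹ • w)) := by
  rcases eq_or_ne j 0 with rfl | hj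
  · simp only [pd_zero, regLog, logNorm_smul (inv_pos.2 hε) hw, Real.log_inv, MultiIndex.order]
    simp; ring
  · rw [pd_logNorm_smul j hj (inv_pos.2 hε) hw, show pd j (regLog ε) w = _ from
      pd_comp_smul_add j hj smoothLog ε⁻¹ (Real.log ε) w]
    ring

theorem pd_smoothLog_eq (j : MultiIndex) {w : ℂ} (hw : 1 ≤ ‖w‖) :
    pd j smoothLog w = pd j logNorm w := by
  refine eqOn_pd (U := {w : ℂ | 1 / 2 < ‖w‖}) (isOpen_lt continuous_const continuous_norm) j
    (fun x hx => smoothLog_eq (le_of_lt hx)) ?_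
  change 1 / 2 < ‖w‖
  linarith

theorem pd_regLog_eq (j : MultiIndex) {ε : ℝ} (hε : 0 < ε) {w : ℂ} (hw : ε ≤ ‖w‖) :
    pd j (regLog ε) w = pd j logNorm w := by
  have hw0 : w ≠ 0 := norm_pos_iff.1 (hε.trans_le hw)
  rw [← sub_eq_zero, pd_regLog_sub j hε hw0, pd_smoothLog_eq, sub_self, mul_zero]
  rw [norm_smul, Real.norm_of_nonneg (inv_pos.2 hε).le, ← div_eq_inv_mul, one_le_div hε]
  exact hw

theorem continuousOn_pd_logNorm (j : MultiIndex) : ContinuousOn (pd j logNorm) {0}ᶜ :=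
  (contDiffOn_pd (m := 0) isOpen_compl_singleton j (contDiffOn_logNorm _)).continuousOn

/-- By homogeneity the derivatives of positive order are controlled by their maximum on the unit
circle. With truncated subtraction the exponent is $\max(|j|,1)$: at order 0 the logarithm is
absorbed into $1/|w|$. -/
theorem exists_abs_pd_logNorm_le (j : MultiIndex) : ∃ C : ℝ, 0 ≤ C ∧ ∀ w : ℂ, w ≠ 0 → ‖w‖ ≤ 1 →
    |pd j logNorm w| ≤ C / ‖w‖ ^ (j.order - 1 + 1) := by
  rcases eq_or_ne j 0 with rfl | hj
  · refine ⟨1, zero_le_one, fun w hw hw1 => ?_⟩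
    have hpos := norm_pos_iff.2 hw
    have : (0 : MultiIndex).order - 1 + 1 = 1 := rfl
    rw [pd_zero, this, pow_one, logNorm, abs_of_nonpos (Real.log_nonpos hpos.le hw1),
      ← Real.log_inv, one_div]
    exact (Real.log_le_sub_one_of_pos (inv_pos.2 hpos)).trans (by linarith)
  · obtain ⟨C, hC⟩ := (isCompact_sphere (0 : ℂ) 1).exists_bound_of_continuousOn
      ((continuousOn_pd_logNorm j).mono fun x hx => by
        rintro rfl; simp at hx)
    have hC0 : 0 ≤ C := (norm_nonneg _).trans (hC 1 (by simp))
    refine ⟨C, hC0, fun w hw _ => ?_⟩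
    have hpos := norm_pos_iff.2 hw
    have ho : j.order - 1 + 1 = j.order := by
      have : j.order ≠ 0 := fun h => hj (by
        simp only [MultiIndex.order] at h
        exact Prod.ext (by simp; omega) (by simp; omega))
      omega
    rw [ho, pd_logNorm_smul j hj (inv_pos.2 hpos) hw, abs_mul, abs_of_nonneg (by positivity),
      inv_pow, ← div_eq_inv_mul]
    gcongr
    refine hC _ ?_
    rw [mem_sphere_zero_iff_norm, norm_smul, norm_inv, norm_norm, inv_mul_cancel₀ hpos.ne']

/-- The regularized kernel approximates the kernel, with the natural bounds on all derivatives. -/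
theorem exists_abs_pd_regLog_sub_le (j : MultiIndex) : ∃ C : ℝ, 0 ≤ C ∧ ∀ ε : ℝ, 0 < ε → ε ≤ 1 →
    ∀ w : ℂ, w ≠ 0 → |pd j (regLog ε) w - pd j logNorm w| ≤ C / ‖w‖ ^ (j.order - 1 + 1) := by
  obtain ⟨C₁, hC₁, h₁⟩ := exists_abs_pd_logNorm_le j
  obtain ⟨C₂, h₂⟩ := (isCompact_closedBall (0 : ℂ) 1).exists_bound_of_continuousOn
    (contDiff_pd j contDiff_smoothLog 0).continuous.continuousOn
  have hC₂ : 0 ≤ C₂ := (norm_nonneg _).trans (h₂ 0 (by simp))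
  refine ⟨C₂ + C₁, by positivity, fun ε hε hε1 w hw => ?_⟩
  have hpos := norm_pos_iff.2 hw
  rcases le_or_gt ε ‖w‖ with hle | hlt
  · rw [pd_regLog_eq j hε hle, sub_self, abs_zero]; positivity
  · rw [pd_regLog_sub j hε hw, abs_mul, abs_of_nonneg (by positivity)]
    set x := ε⁻¹ • w with hx
    have hxn : ‖x‖ = ‖w‖ / ε := by
      rw [hx, norm_smul, Real.norm_of_nonneg (inv_pos.2 hε).le, div_eq_inv_mul]
    have hx1 : ‖x‖ ≤ 1 := by rw [hxn, div_le_one hε]; exact hlt.le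
    have hx0 : x ≠ 0 := norm_pos_iff.1 (by rw [hxn]; positivity)
    set M := j.order - 1 + 1 with hM
    have hxM : ‖x‖ ^ M ≤ 1 := pow_le_one₀ (norm_nonneg _) hx1
    have hxp : 0 < ‖x‖ ^ M := pow_pos (norm_pos_iff.2 hx0) _
    have b1 : |pd j smoothLog x - pd j logNorm x| ≤ (C₂ + C₁) / ‖x‖ ^ M := by
      calc _ ≤ |pd j smoothLog x| + |pd j logNorm x| := abs_sub _ _
        _ ≤ C₂ + C₁ / ‖x‖ ^ M := add_le_add (h₂ x (by simpa using hx1)) (h₁ x hx0 hx1)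
        _ ≤ C₂ / ‖x‖ ^ M + C₁ / ‖x‖ ^ M := by
          gcongr
          rw [le_div_iff₀ hxp]
          exact mul_le_of_le_one_right hC₂ hxM
        _ = _ := by ring
    -- Raising the exponent from $|j|$ to `M` costs nothing since $\varepsilon\le1$; then
    -- $\varepsilon^{-M}|x|^{-M}=|w|^{-M}$, so the bound is free of $\varepsilon$.
    calc ε⁻¹ ^ j.order * |pd j smoothLog x - pd j logNorm x|
        ≤ ε⁻¹ ^ M * ((C₂ + C₁) / ‖x‖ ^ M) := by
          gcongr
          · exact (one_le_inv₀ hε).2 hε1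
          · omega
      _ = _ := by
        rw [hxn, div_pow, inv_pow]
        field_simp

theorem integrableOn_norm_rpow {ν : ℝ} (hν : 0 < ν) (R : ℝ) :
    IntegrableOn (fun w : ℂ => ‖w‖ ^ (-2 + ν)) (Metric.ball 0 R) := by
  refine integrableOn_ball_of_norm_le_rpow (C := 1) (α := 2 - ν) (by simp) (by simpa using hν) ?_
    (measurable_norm.pow_const _).aestronglyMeasurable
  refine Eventually.of_forall fun x => ?_
  rw [Real.norm_of_nonneg (by positivity), one_mul]
  exact le_of_eq (by ring_nf)

/-- The integral of `|ζ - z| ^ (-2 + ν)` over the disk of radius `ε` about `z`. -/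
noncomputable def weakMass (ν ε : ℝ) : ℝ := ∫ w in Metric.ball (0 : ℂ) ε, ‖w‖ ^ (-2 + ν)

/-- Absolute continuity of the integral: $|w|^{-2+\nu}$ is integrable on the unit disk and the areas
of the small disks tend to 0. -/
theorem tendsto_weakMass {ν : ℝ} (hν : 0 < ν) : Tendsto (weakMass ν) (𝓝[>] 0) (𝓝 0) := by
  have h := (integrableOn_norm_rpow hν 1).tendsto_setIntegral_nhds_zero (l := 𝓝[>] (0 : ℝ))
    (s := fun ε => Metric.ball (0 : ℂ) ε) ?_
  · refine h.congr' ?_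
    filter_upwards [Ioo_mem_nhdsGT (zero_lt_one (α := ℝ))] with ε hε
    rw [weakMass, Measure.restrict_restrict measurableSet_ball,
      inter_eq_self_of_subset_left (Metric.ball_subset_ball hε.2.le)]
  · have h0 : Tendsto (fun ε : ℝ => ENNReal.ofReal ε ^ 2 * NNReal.pi) (𝓝[>] 0) (𝓝 0) := by
      have h1 : Tendsto (fun ε : ℝ => ENNReal.ofReal ε) (𝓝[>] 0) (𝓝 0) := by
        simpa using ENNReal.tendsto_ofReal (tendsto_nhdsWithin_of_tendsto_nhds (s := Ioi 0)
          (tendsto_id (x := 𝓝 (0 : ℝ))))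
      simpa using ENNReal.Tendsto.mul_const (ENNReal.Tendsto.pow (n := 2) h1)
        (b := (NNReal.pi : ENNReal)) (Or.inr (by simp))
    refine tendsto_of_tendsto_of_tendsto_of_le_of_le tendsto_const_nhds h0 (fun _ => zero_le) ?_
    intro ε
    refine (Measure.restrict_apply_le _ _).trans ?_
    rw [Complex.volume_ball]

theorem integrableOn_ball_norm_sub_rpow {ν : ℝ} (hν : 0 < ν) (z : ℂ) (ε : ℝ) :
    IntegrableOn (fun ζ : ℂ => ‖ζ - z‖ ^ (-2 + ν)) (Metric.ball z ε) := by
  have h := integrableOn_norm_rpow hν ε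
  rw [← integrable_indicator_iff measurableSet_ball] at h ⊢
  refine (h.comp_sub_right z).congr (Eventually.of_forall fun ζ => ?_)
  simp [indicator, dist_eq_norm]

theorem setIntegral_ball_norm_sub_rpow (ν : ℝ) (z : ℂ) (ε : ℝ) :
    ∫ ζ in Metric.ball z ε, ‖ζ - z‖ ^ (-2 + ν) = weakMass ν ε := by
  rw [weakMass, ← integral_indicator measurableSet_ball, ← integral_indicator measurableSet_ball,
    ← integral_sub_right_eq_self ((Metric.ball (0 : ℂ) ε).indicator _) z]
  congr 1
  funext ζ
  simp [indicator, dist_eq_norm]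

end Kernel

/-! ### Potentials with smooth kernels -/

section Potential

variable {r : ℝ} {k f : ℂ → ℝ}

/-- The potential `∬_{D_r} k(z - ζ) f(ζ) dσ_ζ` of `f` with kernel `k`. -/
noncomputable def potential (r : ℝ) (f k : ℂ → ℝ) (z : ℂ) : ℝ := ∫ ζ in disk r, k (z - ζ) * f ζ

theorem exists_bound_of_mem_disk {E : Type*} [NormedAddCommGroup E]
    {K : ℂ → E} (hK : Continuous K) (z : ℂ) :
    ∃ C : ℝ, ∀ x ∈ Metric.ball z 1, ∀ ζ ∈ disk r, ‖K (x - ζ)‖ ≤ C := by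
  obtain ⟨C, hC⟩ := (isCompact_closedBall (0 : ℂ) (‖z‖ + 1 + r)).exists_bound_of_continuousOn
    hK.continuousOn
  refine ⟨C, fun x hx ζ hζ => hC _ ?_⟩
  rw [mem_closedBall_zero_iff]
  have h1 : ‖x - z‖ < 1 := by rwa [← mem_ball_iff_norm]
  have h2 : ‖ζ‖ < r := hζ
  have h3 := norm_sub_le x ζ
  have h4 := norm_le_norm_add_norm_sub' x z
  linarith

theorem integrableOn_kernel_mul (hk : Continuous k) (hf : IntegrableOn f (disk r)) (z : ℂ) :
    IntegrableOn (fun ζ => k (z - ζ) * f ζ) (disk r) := by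
  obtain ⟨C, hC⟩ := exists_bound_of_mem_disk (r := r) hk z
  refine Integrable.bdd_mul (c := C) hf
    (hk.comp (continuous_const.sub continuous_id)).aestronglyMeasurable ?_
  exact (ae_restrict_iff' (measurableSet_disk r)).2 (Eventually.of_forall fun ζ hζ =>
    hC z (Metric.mem_ball_self one_pos) ζ hζ)

/-- As `f` is only integrable, all derivatives fall on the kernel. For `x` near `z` the points `x -
ζ` stay in a compact set, so a constant multiple of $|f|$ dominates. -/
theorem hasFDerivAt_potential (hk : ContDiff ℝ 1 k) (hf : IntegrableOn f (disk r)) (z : ℂ) :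
    HasFDerivAt (potential r f k) (∫ ζ in disk r, f ζ • fderiv ℝ k (z - ζ)) z ∧
      IntegrableOn (fun ζ => f ζ • fderiv ℝ k (z - ζ)) (disk r) := by
  have hk' : Continuous (fderiv ℝ k) := hk.continuous_fderiv (by simp)
  obtain ⟨C, hC⟩ := exists_bound_of_mem_disk (r := r) hk' z
  have hsub : Continuous fun ζ : ℂ => z - ζ := by fun_prop
  have hm : AEStronglyMeasurable (fun ζ => f ζ • fderiv ℝ k (z - ζ)) (volume.restrict (disk r)) :=
    hf.aestronglyMeasurable.smul (hk'.comp hsub).aestronglyMeasurable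
  have hb : ∀ᵐ ζ ∂volume.restrict (disk r), ∀ x ∈ Metric.ball z 1,
      ‖f ζ • fderiv ℝ k (x - ζ)‖ ≤ |f ζ| * C :=
    (ae_restrict_iff' (measurableSet_disk r)).2 (Eventually.of_forall fun ζ hζ x hx => by
      rw [norm_smul]
      exact mul_le_mul_of_nonneg_left (hC x hx ζ hζ) (norm_nonneg _))
  have hbi : Integrable (fun ζ => |f ζ| * C) (volume.restrict (disk r)) := hf.abs.mul_const C
  refine ⟨hasFDerivAt_integral_of_dominated_of_fderiv_le (bound := fun ζ => |f ζ| * C)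
    (F := fun x ζ => k (x - ζ) * f ζ) (F' := fun x ζ => f ζ • fderiv ℝ k (x - ζ))
    (Metric.ball_mem_nhds z one_pos) (Eventually.of_forall fun x =>
      (integrableOn_kernel_mul hk.continuous hf x).aestronglyMeasurable)
    (integrableOn_kernel_mul hk.continuous hf z) hm hb hbi
    (Eventually.of_forall fun ζ x _ => ?_), Integrable.mono' hbi hm ?_⟩
  · have h1 : HasFDerivAt (fun x => k (x - ζ)) (fderiv ℝ k (x - ζ)) x := by
      have := ((hk.differentiable (by simp)) (x - ζ)).hasFDerivAt.comp x
        ((hasFDerivAt_id x).sub_const ζ)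
      exact this
    exact h1.mul_const (f ζ)
  · exact hb.mono fun ζ h => h z (Metric.mem_ball_self one_pos)

theorem lineDeriv_potential (hk : ContDiff ℝ 1 k) (hf : IntegrableOn f (disk r)) (v : ℂ) :
    (fun z => lineDeriv ℝ (potential r f k) z v) =
      potential r f (fun w => lineDeriv ℝ k w v) := by
  funext z
  obtain ⟨h1, h2⟩ := hasFDerivAt_potential hk hf z
  rw [h1.differentiableAt.lineDeriv_eq_fderiv, h1.fderiv, ContinuousLinearMap.integral_apply h2]
  refine integral_congr_ae (Eventually.of_forall fun ζ => ?_)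
  simp only
  rw [((hk.differentiable (by simp)) _).lineDeriv_eq_fderiv]
  simp [mul_comm]

theorem pd_potential (hk : ∀ m : ℕ, ContDiff ℝ m k) (hf : IntegrableOn f (disk r))
    (j : MultiIndex) : pd j (potential r f k) = potential r f (pd j k) := by
  have key1 : ∀ (a : ℕ) (k : ℂ → ℝ), (∀ m : ℕ, ContDiff ℝ m k) →
      pd₁^[a] (potential r f k) = potential r f (pd₁^[a] k) := by
    intro a
    induction a with
    | zero => exact fun _ _ => rfl
    | succ a ih =>
      intro k hk
      rw [Function.iterate_succ_apply, show pd₁ (potential r f k) = potential r f (pd₁ k) from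
        lineDeriv_potential (hk 1) hf 1, ih (pd₁ k) (contDiff_pd (1, 0) hk),
        Function.iterate_succ_apply]
  have key2 : ∀ (a : ℕ) (k : ℂ → ℝ), (∀ m : ℕ, ContDiff ℝ m k) →
      pd₂^[a] (potential r f k) = potential r f (pd₂^[a] k) := by
    intro a
    induction a with
    | zero => exact fun _ _ => rfl
    | succ a ih =>
      intro k hk
      rw [Function.iterate_succ_apply, show pd₂ (potential r f k) = potential r f (pd₂ k) from
        lineDeriv_potential (hk 1) hf Complex.I, ih (pd₂ k) (contDiff_pd (0, 1) hk),
        Function.iterate_succ_apply]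
  rw [pd, key2 _ _ hk, key1 _ (pd₂^[j.2] k) (contDiff_pd (0, j.2) hk), pd]

theorem contDiff_potential (hk : ∀ m : ℕ, ContDiff ℝ m k) (hf : IntegrableOn f (disk r)) (m : ℕ) :
    ContDiff ℝ m (potential r f k) := by
  have hd : ∀ k : ℂ → ℝ, (∀ m : ℕ, ContDiff ℝ m k) → Differentiable ℝ (potential r f k) :=
    fun k hk z => (hasFDerivAt_potential (hk 1) hf z).1.differentiableAt
  induction m generalizing k with
  | zero => exact contDiff_zero.2 (hd k hk).continuous
  | succ m ih =>
    rw [← contDiffOn_univ]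
    refine contDiffOn_succ_of_pd isOpen_univ (hd k hk).differentiableOn ?_ ?_
    · rw [show pd₁ (potential r f k) = _ from pd_potential hk hf (1, 0)]
      exact (ih (contDiff_pd _ hk)).contDiffOn
    · rw [show pd₂ (potential r f k) = _ from pd_potential hk hf (0, 1)]
      exact (ih (contDiff_pd _ hk)).contDiffOn

end Potential

/-! ### Locally uniform limits of smooth functions -/

section Limits

/-- If all the partial derivatives of order at most `n` of smooth functions `u i` converge locally
uniformly, then the limit is of class `C^n` and its derivatives are the limits of theirs. -/
theorem contDiffOn_of_tendstoLocallyUniformlyOn_pd {ι : Type*} {l : Filter ι} [l.NeBot] {U : Set ℂ}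
    (hU : IsOpen U) (n : ℕ) {u : ι → ℂ → ℝ} (hu : ∀ i, ∀ m : ℕ, ContDiff ℝ m (u i)) {v : ℂ → ℝ}
    (hv : ∀ x ∈ U, Tendsto (fun i => u i x) l (𝓝 (v x)))
    (H : ∀ j : MultiIndex, j.order ≤ n →
      ∃ w, TendstoLocallyUniformlyOn (fun i => pd j (u i)) w l U) :
    ContDiffOn ℝ n v U ∧ ∀ j : MultiIndex, j.order ≤ n → ∀ z ∈ U,
      Tendsto (fun i => pd j (u i) z) l (𝓝 (pd j v z)) := by
  induction n generalizing u v with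
  | zero =>
    obtain ⟨w, hw⟩ := H 0 le_rfl
    have hvw : EqOn v w U := fun x hx => tendsto_nhds_unique (hv x hx) (hw.tendsto_at hx)
    refine ⟨contDiffOn_zero.2 (ContinuousOn.congr (hw.continuousOn (Frequently.of_forall fun i =>
      (hu i 0).continuous.continuousOn)) hvw), fun j hj z hz => ?_⟩
    obtain rfl : j = 0 := by
      simp only [MultiIndex.order] at hj
      exact Prod.ext (by simp; omega) (by simp; omega)
    exact hv z hz
  | succ n ih =>
    obtain ⟨w₁, hw₁⟩ := H (1, 0) (by simp [MultiIndex.order])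
    obtain ⟨w₂, hw₂⟩ := H (0, 1) (by simp [MultiIndex.order])
    have hlim : TendstoLocallyUniformlyOn (fun i => fderiv ℝ (u i))
        (fun z => w₁ z • Complex.reCLM + w₂ z • Complex.imCLM) l U := by
      have h1 := UniformContinuous.comp_tendstoLocallyUniformlyOn
        (ContinuousLinearMap.smulRight (1 : ℝ →L[ℝ] ℝ) Complex.reCLM).uniformContinuous hw₁
      have h2 := UniformContinuous.comp_tendstoLocallyUniformlyOn
        (ContinuousLinearMap.smulRight (1 : ℝ →L[ℝ] ℝ) Complex.imCLM).uniformContinuous hw₂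
      refine (h1.add h2).congr fun i z _ => ?_
      exact (fderiv_eq_pd (((hu i 1).differentiable (by simp)) z)).symm
    have hder : ∀ z ∈ U, HasFDerivAt v (w₁ z • Complex.reCLM + w₂ z • Complex.imCLM) z :=
      fun z hz => hasFDerivAt_of_tendstoLocallyUniformlyOn hU hlim
        (fun i x _ => (((hu i 1).differentiable (by simp)) x).hasFDerivAt) hv hz
    have e₁ : EqOn (pd₁ v) w₁ U := fun z hz => by
      rw [pd₁, (hder z hz).differentiableAt.lineDeriv_eq_fderiv, (hder z hz).fderiv]
      simp
    have e₂ : EqOn (pd₂ v) w₂ U := fun z hz => by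
      rw [pd₂, (hder z hz).differentiableAt.lineDeriv_eq_fderiv, (hder z hz).fderiv]
      simp
    -- The induction hypothesis is applied to the derivatives `pd e (u i)`, whose limit `w` has just
    -- been identified with a first partial derivative of `v`.
    have hstep : ∀ (e : MultiIndex) (w : ℂ → ℝ), e.order = 1 →
        TendstoLocallyUniformlyOn (fun i => pd e (u i)) w l U →
        ContDiffOn ℝ n w U ∧ ∀ j : MultiIndex, j.order ≤ n → ∀ z ∈ U,
          Tendsto (fun i => pd (j + e) (u i) z) l (𝓝 (pd j w z)) := by
      intro e w he hw
      have := ih (u := fun i => pd e (u i)) (v := w) (fun i => contDiff_pd e (hu i))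
        (fun x hx => hw.tendsto_at hx) (fun j hj => by
          simp only [pd_pd_of_contDiff j e (hu _)]
          exact H (j + e) (by rw [MultiIndex.order_add]; omega))
      refine ⟨this.1, fun j hj z hz => ?_⟩
      have h := this.2 j hj z hz
      simpa only [pd_pd_of_contDiff j e (hu _)] using h
    obtain ⟨c₁, t₁⟩ := hstep (1, 0) w₁ rfl hw₁
    obtain ⟨c₂, t₂⟩ := hstep (0, 1) w₂ rfl hw₂
    refine ⟨contDiffOn_succ_of_pd hU (fun z hz =>
      (hder z hz).differentiableAt.differentiableWithinAt) (c₁.congr e₁) (c₂.congr e₂), ?_⟩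
    rintro ⟨a, b⟩ hj z hz
    simp only [MultiIndex.order] at hj
    -- The derivative applied first is the one split off: a $\partial_2$ if there is one, otherwise
    -- a $\partial_1$. With this choice the identities needed hold by unfolding `pd`.
    rcases b with _ | b
    · rcases a with _ | a
      · exact hv z hz
      · have h := t₁ (a, 0) (by simp only [MultiIndex.order]; omega) z hz
        rwa [← eqOn_pd hU (a, 0) e₁ hz] at h
    · have h := t₂ (a, b) (by simp only [MultiIndex.order]; omega) z hz
      rwa [← eqOn_pd hU (a, b) e₂ hz] at h

end Limits

/-! ### Area and boundary representation of the derivatives -/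

section Representation

variable {r R : ℝ} {f : ℂ → ℝ} {m : ℕ} {j : MultiIndex} {e : ℕ → MultiIndex}

theorem IsDecomposition.theta_eq (he : IsDecomposition m j e) : theta e m = j := he.2

theorem theta_succ (e : ℕ → MultiIndex) (s : ℕ) : theta e (s + 1) = e (s + 1) + theta e s := by
  rw [theta, Finset.sum_Icc_succ_top (by omega), add_comm, theta]

theorem phi_eq_add (e : ℕ → MultiIndex) {s : ℕ} (hs : s + 2 ≤ m) :
    phi m e s = e (s + 2) + phi m e (s + 1) := by
  rw [phi, phi, ← Finset.add_sum_Ioc_eq_sum_Icc hs, ← Finset.Icc_add_one_left_eq_Ioc,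
    add_right_comm]

theorem phi_last (e : ℕ → MultiIndex) : phi m e (m - 1) = 0 := by
  rw [phi, Finset.Icc_eq_empty (by omega), Finset.sum_empty]

theorem IsDecomposition.order_phi (he : IsDecomposition m j e) (τ : ℕ) :
    (phi m e τ).order = m - (τ + 1) := by
  have h : (phi m e τ).order = ∑ k ∈ Finset.Icc (τ + 2) m, (e k).order := by
    simp only [MultiIndex.order, phi, Prod.fst_sum, Prod.snd_sum, Finset.sum_add_distrib]
  rw [h, Finset.sum_congr rfl (g := fun _ => 1) (fun k hk => ?_)]
  · simp
  · rw [Finset.mem_Icc] at hk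
    rcases he.1 k (Finset.mem_Icc.2 ⟨by omega, hk.2⟩) with h | h <;> rw [h] <;> rfl

theorem exists_isDecomposition (j : MultiIndex) : ∃ e, IsDecomposition j.order j e := by
  refine ⟨fun τ => if τ ≤ j.1 then (1, 0) else (0, 1), fun τ _ => ?_, ?_⟩
  · by_cases h : τ ≤ j.1 <;> simp [h]
  · have h1 : (Finset.Icc 1 (j.1 + j.2)).filter (fun τ => τ ≤ j.1) = Finset.Icc 1 j.1 := by
      ext; simp; omega
    have h2 : (Finset.Icc 1 (j.1 + j.2)).filter (fun τ => ¬ τ ≤ j.1) =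
        Finset.Icc (j.1 + 1) (j.1 + j.2) := by
      ext; simp; omega
    rw [MultiIndex.order, Finset.sum_ite, h1, h2]
    simp

/-- The sum of boundary integrals for the kernel `k` and the Taylor coefficients `c`. -/
noncomputable def boundarySum (m : ℕ) (e : ℕ → MultiIndex) (R : ℝ) (k : ℂ → ℝ) (c : MultiIndex → ℝ)
    (z : ℂ) : ℝ :=
  ∑ τ ∈ Finset.Icc 1 (m - 1), boundaryIntegral R (fun ζ => pd (theta e τ) k (z - ζ) *
    taylorSum τ (fun α => c (α + phi m e τ)) z ζ * normalDot ζ (e (τ + 1)))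

/-- Repeated integration by parts against a polynomial leaves only boundary terms. -/
theorem setIntegral_disk_pd_mul_taylorSum (hR : 0 < R) (he : IsDecomposition m j e) {k : ℂ → ℝ}
    (hk : ∀ m : ℕ, ContDiff ℝ m k) (c : MultiIndex → ℝ) (z : ℂ) :
    ∫ ζ in disk R, pd j k (z - ζ) * taylorSum (m - 1) c z ζ = -boundarySum m e R k c z := by
  -- With `s + 1` derivatives on the kernel, the polynomial has degree below `s` and the remaining
  -- `m - (s + 1)` derivatives, $\varphi_s$, have already shifted its coefficients. At `s = 0` the
  -- polynomial is the empty sum; `s = m - 1` is the claim.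
  have key : ∀ s, s + 1 ≤ m → ∫ ζ in disk R, pd (theta e (s + 1)) k (z - ζ) *
      taylorSum s (fun α => c (α + phi m e s)) z ζ =
      -∑ τ ∈ Finset.Icc 1 s, boundaryIntegral R (fun ζ => pd (theta e τ) k (z - ζ) *
        taylorSum τ (fun α => c (α + phi m e τ)) z ζ * normalDot ζ (e (τ + 1))) := by
    intro s
    induction s with
    | zero => intro _; simp [taylorSum]
    | succ s ih =>
      intro hs
      have hunit : e (s + 2) = (1, 0) ∨ e (s + 2) = (0, 1) :=
        he.1 _ (Finset.mem_Icc.2 ⟨by omega, hs⟩)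
      have h := setIntegral_disk_pd_mul hR (contDiff_pd (theta e (s + 1)) hk 1)
        (contDiff_taylorSum (s + 1) (fun α => c (α + phi m e (s + 1))) z 1) hunit z
      rw [pd_pd_of_contDiff _ _ hk, ← theta_succ e (s + 1)] at h
      rw [Finset.sum_Icc_succ_top (by omega), h]
      simp only [pd_taylorSum_succ _ _ _ _ hunit, add_assoc, ← phi_eq_add e hs]
      rw [ih (by omega)]
      ring
  rcases Nat.eq_zero_or_pos m with rfl | hm
  · simp [taylorSum, boundarySum]
  · have := key (m - 1) (by omega)
    rwa [Nat.sub_add_cancel hm, he.theta_eq, phi_last] at this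

/-- The derivative of the potential with a smooth kernel, in the form which survives the passage
to the logarithmic kernel. -/
theorem potential_pd_eq (hr : 0 < r) (hR : r < R) (hf : IntegrableOn f (disk r))
    (he : IsDecomposition m j e) {k : ℂ → ℝ} (hk : ∀ m : ℕ, ContDiff ℝ m k) (c : MultiIndex → ℝ)
    (z : ℂ) : IntegrableOn (fun ζ => pd j k (z - ζ) *
        ((disk r).indicator f ζ - taylorSum (m - 1) c z ζ)) (disk R) ∧
      potential r f (pd j k) z = (∫ ζ in disk R, pd j k (z - ζ) *
        ((disk r).indicator f ζ - taylorSum (m - 1) c z ζ)) - boundarySum m e R k c z := by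
  have hfi : Integrable ((disk r).indicator f) :=
    (integrable_indicator_iff (measurableSet_disk r)).2 hf
  have hkc : Continuous (pd j k) := (contDiff_pd j hk 0).continuous
  have hsub : Continuous fun ζ : ℂ => z - ζ := by fun_prop
  have hTc : Continuous (taylorSum (m - 1) c z) := (contDiff_taylorSum _ _ _ 0).continuous
  have i1 : IntegrableOn (fun ζ => pd j k (z - ζ) * (disk r).indicator f ζ) (disk R) :=
    integrableOn_kernel_mul hkc hfi.integrableOn z
  have i2 : IntegrableOn (fun ζ => pd j k (z - ζ) * taylorSum (m - 1) c z ζ) (disk R) :=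
    (((hkc.comp hsub).mul hTc).continuousOn.integrableOn_compact
      (isCompact_closedBall 0 R)).mono_set
      fun ζ hζ => by simpa using le_of_lt (show ‖ζ‖ < R from hζ)
  simp only [mul_sub]
  refine ⟨i1.sub i2, ?_⟩
  rw [integral_sub i1 i2, setIntegral_disk_pd_mul_taylorSum (hr.trans hR) he hk]
  have : ∀ ζ, pd j k (z - ζ) * (disk r).indicator f ζ =
      (disk r).indicator (fun ζ => pd j k (z - ζ) * f ζ) ζ := fun ζ => by
    by_cases h : ζ ∈ disk r <;> simp [h]
  simp only [this]
  have hrR : disk r ⊆ disk R := fun ζ hζ => lt_trans (show ‖ζ‖ < r from hζ) hR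
  rw [setIntegral_indicator (measurableSet_disk r), inter_eq_self_of_subset_right hrR, potential]
  ring

/-- A point of $\partial D_R$ is at distance at least $R-r\ge\varepsilon$ from `z`, and there the
two kernels have the same derivatives. -/
theorem boundarySum_regLog {ε : ℝ} (hε : 0 < ε) (hεR : ε ≤ R - r) (hr : 0 < r) (c : MultiIndex → ℝ)
    {z : ℂ} (hz : z ∈ disk r) :
    boundarySum m e R (regLog ε) c z = boundarySum m e R logNorm c z := by
  refine Finset.sum_congr rfl fun τ _ => ?_
  refine intervalIntegral.integral_congr fun t _ => ?_
  have hn : ε ≤ ‖z - circleMap 0 R t‖ := by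
    have h1 : ‖circleMap 0 R t‖ = R := by simp; linarith
    have h2 := norm_sub_norm_le (circleMap 0 R t) z
    have h3 : ‖z‖ < r := hz
    rw [norm_sub_rev] at h2
    linarith
  simp only [pd_regLog_eq _ hε hn]

theorem measurable_pd_logNorm (j : MultiIndex) : Measurable (pd j logNorm) :=
  measurable_of_continuousOn_compl_singleton 0 (continuousOn_pd_logNorm j)

/-- Replacing the logarithmic kernel by the regularized one changes the area integral only by a
quantity which is small, uniformly for `z` near a given point. -/
theorem exists_regLog_sub_logNorm_bound {N : ℕ} {ν : ℝ≥0} (hν0 : 0 < ν) (hν : ν ≤ 1)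
    (hf : HolderClass N ν (disk r) f) (hfi : IntegrableOn f (disk r)) (hm : j.order ≤ N + 2)
    (R : ℝ) {z₀ : ℂ} (hz₀ : z₀ ∈ disk r) : ∃ C δ : ℝ, 0 < δ ∧ ∀ z ∈ Metric.ball z₀ δ, ∀ ε ∈ Ioo 0 δ,
      IntegrableOn (fun ζ => (pd j (regLog ε) (z - ζ) - pd j logNorm (z - ζ)) *
        ((disk r).indicator f ζ - taylorSum (j.order - 1) (fun α => pd α f z) z ζ)) (disk R) ∧
      |∫ ζ in disk R, (pd j (regLog ε) (z - ζ) - pd j logNorm (z - ζ)) *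
        ((disk r).indicator f ζ - taylorSum (j.order - 1) (fun α => pd α f z) z ζ)| ≤
          C * weakMass ν ε := by
  obtain ⟨C₁, δ, hC₁, hδ, hball, hT⟩ := hf.exists_abs_sub_taylorSum_le hν (isOpen_disk r)
    (q := j.order - 1) (by omega) hz₀
  obtain ⟨C₂, hC₂, hK⟩ := exists_abs_pd_regLog_sub_le j
  -- With `z` within `δ / 2` of `z₀` and `ε < δ / 2`, the disk of radius `ε` about `z` lies where
  -- the Taylor estimate holds; `ε ≤ 1` is required by the kernel bound.
  refine ⟨C₂ * C₁, min (δ / 2) 1, by positivity, fun z hz ε hε => ?_⟩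
  have hε0 : 0 < ε := hε.1
  have hεδ : ε < δ / 2 := hε.2.trans_le (min_le_left _ _)
  have hε1 : ε ≤ 1 := hε.2.le.trans (min_le_right _ _)
  have hzδ : dist z z₀ < δ / 2 := lt_of_lt_of_le (Metric.mem_ball.1 hz) (min_le_left _ _)
  set q := j.order - 1 with hq
  set h : ℂ → ℝ := fun ζ => (pd j (regLog ε) (z - ζ) - pd j logNorm (z - ζ)) *
    ((disk r).indicator f ζ - taylorSum q (fun α => pd α f z) z ζ) with hh
  set b : ℂ → ℝ := (Metric.ball z ε).indicator (fun ζ => C₂ * C₁ * ‖ζ - z‖ ^ (-2 + (ν : ℝ))) with hb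
  have hbi : Integrable b := (integrable_indicator_iff measurableSet_ball).2
    ((integrableOn_ball_norm_sub_rpow (NNReal.coe_pos.2 hν0) z ε).const_mul _)
  have hsub : Measurable fun ζ : ℂ => z - ζ := by fun_prop
  have hmeas : AEStronglyMeasurable h := by
    have hfm : AEStronglyMeasurable ((disk r).indicator f) :=
      ((integrable_indicator_iff (measurableSet_disk r)).2 hfi).aestronglyMeasurable
    exact ((((contDiff_pd j (contDiff_regLog ε) 0).continuous.measurable.comp hsub).sub
      ((measurable_pd_logNorm j).comp hsub)).aestronglyMeasurable).mul
      (hfm.sub (contDiff_taylorSum _ _ _ 0).continuous.aestronglyMeasurable)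
  have hle : ∀ᵐ ζ, ‖h ζ‖ ≤ b ζ := by
    filter_upwards [compl_mem_ae_iff.2 (measure_singleton z)] with ζ hζ
    have hne : ζ ≠ z := hζ
    have hw : z - ζ ≠ 0 := sub_ne_zero.2 hne.symm
    by_cases hζb : ζ ∈ Metric.ball z ε
    · have hζδ : ζ ∈ Metric.ball z₀ δ := by
        have := dist_triangle ζ z z₀
        rw [Metric.mem_ball] at hζb ⊢; linarith
      have hz' : z ∈ Metric.ball z₀ δ := by rw [Metric.mem_ball]; linarith
      have hpos : 0 < ‖ζ - z‖ := norm_pos_iff.2 (sub_ne_zero.2 hne)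
      rw [hb, indicator_of_mem hζb, hh]
      simp only
      rw [indicator_of_mem (hball hζδ), norm_mul]
      -- The exponents combine to $(q-1+\nu)-(q+1)=-2+\nu$ whatever the order, which is why a single
      -- majorant works for all derivatives.
      calc _ ≤ C₂ / ‖z - ζ‖ ^ (q + 1) * (C₁ * ‖ζ - z‖ ^ ((q : ℝ) - 1 + ν)) :=
            mul_le_mul (hK ε hε0 hε1 _ hw) (hT z hz' ζ hζδ hne) (abs_nonneg _) (by positivity)
        _ = C₂ * C₁ * (‖ζ - z‖ ^ ((q : ℝ) - 1 + ν) / ‖ζ - z‖ ^ (q + 1)) := by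
            rw [norm_sub_rev z ζ]; ring
        _ = _ := by
            rw [← Real.rpow_natCast, ← Real.rpow_sub hpos]
            congr 2
            push_cast; ring
    · rw [hb, indicator_of_notMem hζb, hh]
      simp only
      rw [pd_regLog_eq j hε0, sub_self, zero_mul, norm_zero]
      rw [norm_sub_rev, ← dist_eq_norm]
      simpa using hζb
  have hhi : Integrable h := hbi.mono' hmeas hle
  refine ⟨hhi.integrableOn, ?_⟩
  calc |∫ ζ in disk R, h ζ| ≤ ∫ ζ in disk R, ‖h ζ‖ :=
        norm_integral_le_integral_norm (μ := volume.restrict (disk R)) h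
    _ ≤ ∫ ζ, ‖h ζ‖ := setIntegral_le_integral hhi.norm (Eventually.of_forall fun _ => norm_nonneg _)
    _ ≤ ∫ ζ, b ζ := integral_mono_ae hhi.norm hbi hle
    _ = C₂ * C₁ * weakMass ν ε := by
      rw [hb, integral_indicator measurableSet_ball, integral_const_mul,
        setIntegral_ball_norm_sub_rpow]

/-- The exact formula for the smooth kernels passes to the limit: the boundary sums are eventually
constant in `ε` and the area integrals differ by at most `C * weakMass ν ε`, uniformly near each
point. All orders `m ≤ N + 2` are covered, since the convergence criterion for $C^{N+2}$ needs the
lower ones too. -/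
theorem tendstoLocallyUniformlyOn_pd_potential {N : ℕ} {ν : ℝ≥0} (hν0 : 0 < ν) (hν : ν ≤ 1)
    (hr : 0 < r) (hR : r < R) (hf : HolderClass N ν (disk r) f) (hfi : IntegrableOn f (disk r))
    (hm : m ≤ N + 2) (hj : j.order = m) (he : IsDecomposition m j e) :
    (∀ z ∈ disk r, IntegrableOn (fun ζ => pd j logNorm (z - ζ) *
      ((disk r).indicator f ζ - taylorSum (m - 1) (fun α => pd α f z) z ζ)) (disk R)) ∧
    TendstoLocallyUniformlyOn (fun ε => pd j (potential r f (regLog ε)))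
      (fun z => (∫ ζ in disk R, pd j logNorm (z - ζ) *
        ((disk r).indicator f ζ - taylorSum (m - 1) (fun α => pd α f z) z ζ)) -
        boundarySum m e R logNorm (fun α => pd α f z) z) (𝓝[>] 0) (disk r) := by
  subst hj
  have hloc : ∀ z₀ ∈ disk r, ∃ C δ : ℝ, 0 < δ ∧ ∀ z ∈ Metric.ball z₀ δ, ∀ ε ∈ Ioo 0 δ,
      IntegrableOn (fun ζ => pd j logNorm (z - ζ) * ((disk r).indicator f ζ -
        taylorSum (j.order - 1) (fun α => pd α f z) z ζ)) (disk R) ∧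
      |(∫ ζ in disk R, pd j (regLog ε) (z - ζ) * ((disk r).indicator f ζ -
        taylorSum (j.order - 1) (fun α => pd α f z) z ζ)) -
        ∫ ζ in disk R, pd j logNorm (z - ζ) * ((disk r).indicator f ζ -
        taylorSum (j.order - 1) (fun α => pd α f z) z ζ)| ≤ C * weakMass ν ε := by
    intro z₀ hz₀
    obtain ⟨C, δ, hδ, H⟩ := exists_regLog_sub_logNorm_bound hν0 hν hf hfi hm R hz₀
    refine ⟨C, δ, hδ, fun z hz ε hε => ?_⟩
    obtain ⟨h1, h2⟩ := H z hz ε hε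
    have h3 := (potential_pd_eq hr hR hfi he (contDiff_regLog ε) (fun α => pd α f z) z).1
    -- The singular integrand is the integrand with smooth kernel minus the difference of the two,
    -- both known to be integrable.
    have h4 : IntegrableOn (fun ζ => pd j logNorm (z - ζ) * ((disk r).indicator f ζ -
        taylorSum (j.order - 1) (fun α => pd α f z) z ζ)) (disk R) :=
      (h3.sub h1).congr (Eventually.of_forall fun ζ => by simp only [Pi.sub_apply]; ring)
    refine ⟨h4, ?_⟩
    rw [← integral_sub h3 h4]
    simpa only [sub_mul] using h2
  refine ⟨fun z hz => ?_, ?_⟩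
  · obtain ⟨C, δ, hδ, H⟩ := hloc z hz
    exact (H z (Metric.mem_ball_self hδ) (δ / 2) ⟨by positivity, by linarith⟩).1
  rw [Metric.tendstoLocallyUniformlyOn_iff]
  intro η hη z₀ hz₀
  obtain ⟨C, δ, hδ, H⟩ := hloc z₀ hz₀
  refine ⟨Metric.ball z₀ δ ∩ disk r, inter_mem (mem_nhdsWithin_of_mem_nhds
    (Metric.ball_mem_nhds _ hδ)) self_mem_nhdsWithin, ?_⟩
  have hw : Tendsto (fun ε => C * weakMass ν ε) (𝓝[>] 0) (𝓝 0) := by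
    simpa using (tendsto_weakMass (NNReal.coe_pos.2 hν0)).const_mul C
  filter_upwards [hw.eventually_lt_const hη, Ioo_mem_nhdsGT (lt_min hδ (sub_pos.2 hR))]
    with ε h1 h2 z hz
  rw [pd_potential (contDiff_regLog ε) hfi,
    (potential_pd_eq hr hR hfi he (contDiff_regLog ε) (fun α => pd α f z) z).2,
    boundarySum_regLog h2.1 (h2.2.le.trans (min_le_right _ _)) hr _ hz.2, dist_sub_right, dist_comm,
    Real.dist_eq]
  exact ((H z hz.1 ε ⟨h2.1, h2.2.trans_le (min_le_left _ _)⟩).2).trans_lt h1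

end Representation

/-! ### Regularity of the logarithmic potential and the final formula -/

section MainTheorem

variable {r R : ℝ} {f : ℂ → ℝ} {n : ℕ} {j : MultiIndex} {e : ℕ → MultiIndex}

theorem pd_logKernel (j : MultiIndex) (ζ z : ℂ) : pd j (logKernel ζ) z = pd j logNorm (z - ζ) :=
  pd_comp_sub_const j logNorm ζ z

theorem pd_const_mul (j : MultiIndex) (c : ℝ) (g : ℂ → ℝ) (z : ℂ) :
    pd j (fun w => c * g w) z = c * pd j g z := by
  have key : ∀ (v : ℂ) (g : ℂ → ℝ), (fun w => lineDeriv ℝ (fun w => c * g w) w v) =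
      fun w => c * lineDeriv ℝ g w v := fun v g => funext fun w => deriv_const_mul_field c
  have key1 : ∀ (k : ℕ) (g : ℂ → ℝ), pd₁^[k] (fun w => c * g w) = fun w => c * pd₁^[k] g w := by
    intro k
    induction k with
    | zero => simp
    | succ k ih => exact fun g => (congrArg pd₁^[k] (key 1 g)).trans (ih (pd₁ g))
  have key2 : ∀ (k : ℕ) (g : ℂ → ℝ), pd₂^[k] (fun w => c * g w) = fun w => c * pd₂^[k] g w := by
    intro k
    induction k with
    | zero => simp
    | succ k ih => exact fun g => (congrArg pd₂^[k] (key Complex.I g)).trans (ih (pd₂ g))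
  simp only [pd, key2, key1]

theorem areaIntegrand_eq (hn : 2 ≤ n) (z ζ : ℂ) : areaIntegrand n r f j z ζ =
    pd j logNorm (z - ζ) *
      ((disk r).indicator f ζ - taylorSum (n - 1) (fun α => pd α f z) z ζ) := by
  rw [areaIntegrand, pd_logKernel, taylorPoly_eq_taylorSum, show n - 2 + 1 = n - 1 by omega]

/-- Merging $\partial^\alpha\partial^{\varphi_\tau}$ uses at most $(\tau-1)+(n-\tau-1)=n-2$
derivatives of `f`, exactly the regularity available. -/
theorem boundaryIntegrand_eq (hf : ContDiffOn ℝ (n - 2 : ℕ) f (disk r)) (he : IsDecomposition n j e)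
    {τ : ℕ} (hτ : τ ∈ Finset.Icc 1 (n - 1)) {z : ℂ} (hz : z ∈ disk r) :
    boundaryIntegrand n f e τ z = fun ζ => pd (theta e τ) logNorm (z - ζ) *
      taylorSum τ (fun α => pd (α + phi n e τ) f z) z ζ * normalDot ζ (e (τ + 1)) := by
  rw [Finset.mem_Icc] at hτ
  funext ζ
  rw [boundaryIntegrand, pd_logKernel, taylorPoly_eq_taylorSum, Nat.sub_add_cancel hτ.1]
  congr 2
  refine taylorSum_congr (fun α hα => ?_) z ζ
  refine pd_pd (isOpen_disk r) α (phi n e τ) (hf.of_le ?_) hz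
  rw [he.order_phi]
  norm_cast
  omega

theorem boundaryIntegrable_pd_logNorm_mul (hr : 0 < r) (hR : r < R) {z : ℂ} (hz : z ∈ disk r)
    (θ e : MultiIndex) {P : ℂ → ℝ} (hP : Continuous P) :
    BoundaryIntegrable R (fun ζ => pd θ logNorm (z - ζ) * P ζ * normalDot ζ e) := by
  have hc : Continuous (circleMap 0 R) := continuous_circleMap 0 R
  have hn : ∀ t, ‖circleMap 0 R t‖ = R := fun t => by simp; linarith
  have h0 : ∀ t, ‖circleMap 0 R t‖ ≠ 0 := fun t => by rw [hn]; linarith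
  have h1 : Continuous fun t => pd θ logNorm (z - circleMap 0 R t) := by
    refine (continuousOn_pd_logNorm θ).comp_continuous (continuous_const.sub hc) fun t ht => ?_
    have hz' : ‖z‖ < r := hz
    rw [sub_eq_zero.1 ht, hn] at hz'
    linarith
  have h2 : Continuous fun t => normalDot (circleMap 0 R t) e :=
    (((Complex.continuous_re.comp hc).div hc.norm h0).mul continuous_const).add
      (((Complex.continuous_im.comp hc).div hc.norm h0).mul continuous_const)
  exact (((h1.mul (hP.comp hc)).mul h2).mul continuous_const).intervalIntegrable _ _

/-- The potential is of class `C^n`, and its derivatives of order `n` are given by the area and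
boundary integrals. -/
theorem logPotential_regularity (hr : 0 < r) {ν : ℝ≥0} (hν0 : 0 < ν) (hν : ν ≤ 1) {N : ℕ}
    (hf : HolderClass N ν (disk r) f) (hfi : IntegrableOn f (disk r)) :
    (∀ z ∈ disk r, IntegrableOn (fun ζ => logKernel ζ z * f ζ) (disk r)) ∧
    ContDiffOn ℝ (N + 2 : ℕ) (logPotential (disk r) f) (disk r) ∧
    ∀ j : MultiIndex, j.order = N + 2 → ∀ e, IsDecomposition (N + 2) j e → ∀ R, r < R →
      ∀ z ∈ disk r, pd j (logPotential (disk r) f) z = 1 / (2 * Real.pi) *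
        ((∫ ζ in disk R, pd j logNorm (z - ζ) *
        ((disk r).indicator f ζ - taylorSum (N + 1) (fun α => pd α f z) z ζ)) -
        boundarySum (N + 2) e R logNorm (fun α => pd α f z) z) := by
  have hrr : r < r + 1 := by linarith
  have hsub : disk r ⊆ disk (r + 1) := fun ζ hζ => lt_trans (show ‖ζ‖ < r from hζ) hrr
  -- At order 0 the Taylor sum and the boundary sum are empty and the representation is the
  -- potential itself. Its absolute convergence and the pointwise limit of the regularized
  -- potentials are thus the case `m = 0`, with the empty decomposition and `r + 1` as an arbitrary
  -- outer radius.
  have hind : ∀ z ζ, pd 0 logNorm (z - ζ) * ((disk r).indicator f ζ -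
      taylorSum (0 - 1) (fun α => pd α f z) z ζ) =
      (disk r).indicator (fun ζ => logKernel ζ z * f ζ) ζ := fun z ζ => by
    by_cases h : ζ ∈ disk r <;> simp [h, taylorSum, pd_zero, logNorm, logKernel]
  have hdec : IsDecomposition 0 0 (fun _ => 0) := ⟨by simp, by simp⟩
  obtain ⟨hint, hlim⟩ := tendstoLocallyUniformlyOn_pd_potential hν0 hν hr hrr hf hfi
    (Nat.zero_le _) rfl hdec
  simp only [hind, setIntegral_indicator (measurableSet_disk r),
    inter_eq_self_of_subset_right hsub] at hint hlim
  set V : ℂ → ℝ := fun z => ∫ ζ in disk r, logKernel ζ z * f ζ with hV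
  have hpt : ∀ x ∈ disk r, Tendsto (fun ε => potential r f (regLog ε) x) (𝓝[>] 0) (𝓝 (V x)) := by
    intro x hx
    simpa [boundarySum, pd_zero] using hlim.tendsto_at hx
  obtain ⟨hVc, hVd⟩ := contDiffOn_of_tendstoLocallyUniformlyOn_pd (isOpen_disk r) (N + 2)
    (fun ε m => contDiff_potential (contDiff_regLog ε) hfi m) hpt (fun j hj => by
      obtain ⟨e, he⟩ := exists_isDecomposition j
      exact ⟨_, (tendstoLocallyUniformlyOn_pd_potential hν0 hν hr hrr hf hfi hj rfl he).2⟩)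
  refine ⟨fun z hz => ?_, contDiffOn_const.mul hVc, fun j hj e he R hR z hz => ?_⟩
  · have := (hint z hz).mono_set hsub
    rwa [IntegrableOn, integrable_indicator_iff (measurableSet_disk r), IntegrableOn,
      Measure.restrict_restrict (measurableSet_disk r), inter_self] at this
  · rw [show pd j (logPotential (disk r) f) z = _ from pd_const_mul j (1 / (2 * Real.pi)) V z]
    congr 1
    -- The derivatives of the regularized potentials converge both to the derivative of the limit
    -- and to the representation for the given `R` and `e`.
    exact tendsto_nhds_unique (hVd j hj.le z hz)
      ((tendstoLocallyUniformlyOn_pd_potential hν0 hν hr hR hf hfi le_rfl hj he).2.tendsto_at hz)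

end MainTheorem

end LogPot

theorem mainTheorem1 (n : ℕ) (hn : 3 ≤ n) (r : ℝ) (hr0 : 0 < r) (hr1 : r < 1)
    (ν : ℝ≥0) (hν0 : 0 < ν) (hν1 : ν ≤ 1) (f : ℂ → ℝ)
    (hf : LogPot.HolderClass (n - 2) ν (LogPot.disk r) f)
    (hfi : MeasureTheory.IntegrableOn f (LogPot.disk r)) :
    (∀ z ∈ LogPot.disk r,
      MeasureTheory.IntegrableOn (fun ζ => LogPot.logKernel ζ z * f ζ) (LogPot.disk r)) ∧
    ContDiffOn ℝ n (LogPot.logPotential (LogPot.disk r) f) (LogPot.disk r) ∧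
    ∀ j : LogPot.MultiIndex, j.order = n →
      ∀ e : ℕ → LogPot.MultiIndex, LogPot.IsDecomposition n j e →
        ∀ R : ℝ, r < R → ∀ z ∈ LogPot.disk r,
          MeasureTheory.IntegrableOn (LogPot.areaIntegrand n r f j z) (LogPot.disk R) ∧
          (∀ τ ∈ Finset.Icc 1 (n - 1),
            LogPot.BoundaryIntegrable R (LogPot.boundaryIntegrand n f e τ z)) ∧
          LogPot.pd j (LogPot.logPotential (LogPot.disk r) f) z =
            1 / (2 * Real.pi) * (∫ ζ in LogPot.disk R, LogPot.areaIntegrand n r f j z ζ)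
            - 1 / (2 * Real.pi) * ∑ τ ∈ Finset.Icc 1 (n - 1),
                LogPot.boundaryIntegral R (LogPot.boundaryIntegrand n f e τ z) := by
  obtain ⟨N, rfl⟩ : ∃ N, n = N + 2 := ⟨n - 2, by omega⟩
  have hN : N + 2 - 2 = N := by omega
  obtain ⟨h1, h2, h3⟩ := LogPot.logPotential_regularity hr0 hν0 hν1 (hN ▸ hf) hfi
  refine ⟨h1, h2, fun j hj e he R hR z hz => ⟨?_, fun τ hτ => ?_, ?_⟩⟩
  · have := (LogPot.tendstoLocallyUniformlyOn_pd_potential hν0 hν1 hr0 hR (hN ▸ hf) hfi le_rfl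
      hj he).1 z hz
    exact this.congr (Filter.Eventually.of_forall fun ζ =>
      (LogPot.areaIntegrand_eq (by omega) z ζ).symm)
  · rw [LogPot.boundaryIntegrand_eq hf.1 he hτ hz]
    exact LogPot.boundaryIntegrable_pd_logNorm_mul hr0 hR hz _ _
      (LogPot.contDiff_taylorSum _ _ _ 0).continuous
  · rw [h3 j hj e he R hR z hz, mul_sub]
    simp only [LogPot.areaIntegrand_eq (show 2 ≤ N + 2 by omega)]
    congr 2
    refine Finset.sum_congr rfl fun τ hτ => ?_
    rw [LogPot.boundaryIntegrand_eq hf.1 he hτ hz]
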